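/- Let $\lambda=(\lambda_1\ge\lambda_2\ge\cdots)$ be a partition with conjugate $\lambda'$, and put $|\lambda|=\sum_i\lambda_i$, $n(\lambda)=\sum_{i\ge1}(i-1)\lambda_i$. For a box $x=(i,j)$ of the diagram of a partition $\mu$ let $c(x)=j-i$ be its content and $h(x)=\mu_i-j+\mu'_j-i+1$ its hook length. For an integer $N\ge 0$ the generalized $q$-Gaussian coefficient is $$\left[{N\atop \mu}\right]_q=\prod_{x\in\mu}\frac{1-q^{N-c(x)}}{1-q^{h(x)}},\qquad\text{so that}\qquad \left[{N\atop \lambda'}\right]_q=\prod_{x\in\lambda}\frac{1-q^{N+c(x)}}{1-q^{h(x)}} .$$ Then $\left[{N\atop\lambda'}\right]_q$ is a polynomial in $q$ with integer coefficients; writing it as $\sum_{i=0}^d a_iq^i$ with $d$ its degree ($d=0$ if it is zero), it is symmetric, i.e. $a_i=a_{d-i}$ for $0\le i\le d$, and unimodal, i.e. $a_0\le\cdots\le a_m\ge a_{m+1}\ge\cdots\ge a_d$ for some $m$. If $\lambda$ has at most $N$ nonzero parts (otherwise the coefficient is $0$), it is nonzero, its degree is $(N-1)|\lambda|-2n(\lambda)$,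 and consequently $q^{n(\lambda)}\left[{N\atop\lambda'}\right]_q$ has degree $(N-1)|\lambda|-n(\lambda)$. -/

import Mathlib

namespace GenGauss

/-- `n(lam) = ∑_{i ≥ 1} (i - 1) lam_i`; rows are numbered from `0` here. -/
def nStat (lam : YoungDiagram) : ℕ :=
  ∑ i ∈ Finset.range (lam.colLen 0), i * lam.rowLen i

/-- The content `j - i` of the box in row `i` and column `j`. -/
def content (x : ℕ × ℕ) : ℤ := (x.2 : ℤ) - (x.1 : ℤ)

/-- The hook length (arm + leg + 1) of a box `x` of the diagram. The subtractions are exact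
when `x` belongs to the diagram. -/
def hookLength (lam : YoungDiagram) (x : ℕ × ℕ) : ℕ :=
  (lam.rowLen x.1 - (x.2 + 1)) + (lam.colLen x.2 - (x.1 + 1)) + 1

/-- The generalized Gaussian coefficient, with lower entry an arbitrary partition `mu`:
`∏_{x ∈ mu} (1 - q ^ (N - c(x))) / (1 - q ^ h(x))`, a rational function of `q` with integer
coefficients. For `mu` the conjugate of `lam` it is
`∏_{x ∈ lam} (1 - q ^ (N + c(x))) / (1 - q ^ h(x))`. -/
noncomputable def gaussCoeff (N : ℕ) (mu : YoungDiagram) : RatFunc ℤ :=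
  ∏ x ∈ mu.cells,
    (1 - (RatFunc.X : RatFunc ℤ) ^ ((N : ℤ) - content x)) /
      (1 - (RatFunc.X : RatFunc ℤ) ^ hookLength mu x)

/-- The coefficients `a_0, …, a_d` (`d` the degree) satisfy `a_i = a_{d - i}`. -/
def IsSymmetric (P : Polynomial ℤ) : Prop :=
  ∀ i ≤ P.natDegree, P.coeff i = P.coeff (P.natDegree - i)

/-- The coefficients satisfy `a_0 ≤ ⋯ ≤ a_m ≥ ⋯ ≥ a_d` for some `m`, `d` being the degree. -/
def IsUnimodal (P : Polynomial ℤ) : Prop :=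
  ∃ m ≤ P.natDegree,
    (∀ i < m, P.coeff i ≤ P.coeff (i + 1)) ∧
    (∀ i, m ≤ i → i < P.natDegree → P.coeff (i + 1) ≤ P.coeff i)

end GenGauss

/-! The coefficient is the principal specialization of a Schur function divided by its lowest power
of `q`. It therefore counts Gelfand–Tsetlin patterns of shape `lam` by degree, and the patterns
index a weight basis of an irreducible `gl_N`-module.

Unimodality comes from the principal `sl₂`. On the span of the patterns, the Gelfand–Tsetlin
formulas in a rational normalization define a raising operator `E` and a lowering operator `F = ∑ k
(N - k) F_k`, which shift the degree by one. The only relation needed is that `E F - F E` acts as `2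
d + κ` in degree `d`. Then `E` is injective where this scalar is negative and `F` where it is
positive (`eq_zero_of_raise_eq_zero`), so the numbers of patterns rise and then fall
(`card_patterns_unimodal`). In the commutator, the terms that change two different boxes cancel in
pairs. The diagonal terms of one row are the residues of a rational function, so their sum is a
second difference of row sums, and summation by parts against `k (N - k)` turns these into the
degree.

The product formula comes from the branching rule. Summing a Vandermonde determinant over
interlacing rows gives the next Vandermonde determinant (`sum_interlacing_det_vandermonde`), so the
patterns are counted by the `q`-Weyl product of differences. In each row the hook lengths complement
these differences to an initial interval of integers (`prod_hookLength_row`), which converts that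
product into the hook-content product (`patternPoly_mul_hookPoly`). Symmetry and degree are read off
from the factors `1 - q ^ k`. -/

namespace GenGauss

/-! ### Sums of residues, by Lagrange interpolation. -/

section Residues

variable {ι K : Type*} [DecidableEq ι] [Field K]

/-- The sum of the residues of `∏ (u - n j) / ∏ (u - v j)`, for distinct nodes `v`. -/
theorem sum_residues_of_injOn (s : Finset ι) (v n : ι → K) (hv : Set.InjOn v s) :
    ∑ i ∈ s, (∏ j ∈ s, (v i - n j)) / ∏ j ∈ s.erase i, (v i - v j) =
      ∑ i ∈ s, v i - ∑ i ∈ s, n i := by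
  rcases s.eq_empty_or_nonempty with rfl | hs
  · simp
  -- The difference of the two nodal polynomials takes the values `∏ (v i - n j)` at the nodes. Its
  -- coefficient of degree `card - 1`, computed by interpolation, is the sum of residues.
  have hdeg : (Lagrange.nodal s n - Lagrange.nodal s v).degree < s.card := by
    have h := Polynomial.degree_sub_lt_left
      (p := Lagrange.nodal s n) (q := Lagrange.nodal s v)
      (by rw [Lagrange.degree_nodal, Lagrange.degree_nodal]) Lagrange.nodal_ne_zero
      (by rw [Lagrange.nodal_monic.leadingCoeff, Lagrange.nodal_monic.leadingCoeff])
    rwa [Lagrange.degree_nodal] at h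
  have h := Lagrange.coeff_eq_sum hv hdeg
  rw [Polynomial.coeff_sub, Lagrange.nodal_eq, Lagrange.nodal_eq,
    Polynomial.prod_X_sub_C_coeff_card_pred _ _ hs.card_pos,
    Polynomial.prod_X_sub_C_coeff_card_pred _ _ hs.card_pos] at h
  rw [show ∑ i ∈ s, v i - ∑ i ∈ s, n i = -∑ i ∈ s, n i - -∑ i ∈ s, v i by ring, h]
  refine Finset.sum_congr rfl fun i hi => ?_
  congr 1
  rw [← Lagrange.nodal_eq, ← Lagrange.nodal_eq, Polynomial.eval_sub, Lagrange.eval_nodal,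
    Lagrange.eval_nodal_at_node hi, sub_zero]

/-- The sum of the residues when nodes may coincide, provided that each coinciding node is
cancelled by a zero of the numerator; the corresponding terms of the sum vanish. -/
theorem sum_residues [Fintype ι] (v n : ι → K) (h : ∀ i j, i ≠ j → v i = v j → n i = v i) :
    ∑ i, (∏ j, (v i - n j)) / ∏ j ∈ Finset.univ.erase i, (v i - v j) =
      ∑ i, v i - ∑ i, n i := by
  classical
  -- The indices whose node is not repeated. Every other index has `n i = v i`, so its term is `0 /
  -- 0 = 0` and its factors cancel from the remaining terms.
  let G : Finset ι := Finset.univ.filter fun i => ∀ j, v i = v j → i = j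
  have hG : ∀ i, i ∈ G ↔ ∀ j, v i = v j → i = j := fun i => by simp [G]
  have hbad : ∀ i, i ∉ G → n i = v i := by
    intro i hi
    rw [hG] at hi
    push Not at hi
    obtain ⟨j, hj, hij⟩ := hi
    exact h i j hij hj
  have hinj : Set.InjOn v G := fun i hi j _ hij => (hG i).1 hi j hij
  have key := sum_residues_of_injOn G v n hinj
  have hR : ∑ i, v i - ∑ i, n i = ∑ i ∈ G, v i - ∑ i ∈ G, n i := by
    rw [← Finset.sum_sub_distrib, ← Finset.sum_sub_distrib]
    refine (Finset.sum_subset (Finset.subset_univ G) fun i _ hi => ?_).symm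
    rw [hbad i hi, sub_self]
  rw [hR, ← key]
  symm
  rw [← Finset.sum_subset (Finset.subset_univ G)]
  · refine Finset.sum_congr rfl fun i hi => ?_
    have h1 : ∏ j, (v i - n j) = (∏ j ∈ G, (v i - n j)) * ∏ j ∈ Gᶜ, (v i - v j) := by
      rw [← Finset.prod_mul_prod_compl G]
      congr 1
      refine Finset.prod_congr rfl fun j hj => ?_
      rw [hbad j (by simpa using hj)]
    have h2 : ∏ j ∈ Finset.univ.erase i, (v i - v j) =
        (∏ j ∈ G.erase i, (v i - v j)) * ∏ j ∈ Gᶜ, (v i - v j) := by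
      rw [← Finset.prod_union]
      · congr 1
        ext j
        by_cases hj : j ∈ G
        · simp [hj]
        · simp only [Finset.mem_erase, Finset.mem_univ, and_true, Finset.mem_union,
            Finset.mem_compl, hj, not_false_eq_true, or_true, iff_true]
          rintro rfl
          exact hj hi
      · rw [Finset.disjoint_left]
        intro j hj hj'
        exact (Finset.mem_compl.1 hj') (Finset.mem_of_mem_erase hj)
    have h3 : ∏ j ∈ Gᶜ, (v i - v j) ≠ 0 := by
      rw [Finset.prod_ne_zero_iff]
      intro j hj
      rw [sub_ne_zero]
      intro hij
      obtain rfl := (hG i).1 hi j hij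
      exact Finset.mem_compl.1 hj hi
    rw [h1, h2, mul_div_mul_right _ _ h3]
  · intro i _ hi
    rw [Finset.prod_eq_zero (Finset.mem_univ i) (by rw [hbad i hi, sub_self]), zero_div]

end Residues

/-! ### Injectivity in a graded `sl₂`-module. -/

section SlTwo

variable {K V : Type*} [Field K] [LinearOrder K] [IsStrictOrderedRing K]
  [AddCommGroup V] [Module K V]

/-- In a graded module over the `sl₂`-triple `E`, `F`, `H` with `H = 2 d + κ` in degree `d`, and
with degrees bounded below, the raising operator is injective in degrees of negative weight. -/
theorem eq_zero_of_raise_eq_zero (E F : V →ₗ[K] V) (W : ℤ → Submodule K V) (κ : K) (e : ℤ)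
    (hF : ∀ d, ∀ v ∈ W d, F v ∈ W (d - 1))
    (hEF : ∀ d, ∀ v ∈ W d, E (F v) - F (E v) = (2 * (d : K) + κ) • v)
    (he : ∀ d < e, W d = ⊥) (d : ℤ) (hd : 2 * (d : K) + κ < 0) (v : V) (hv : v ∈ W d)
    (hEv : E v = 0) : v = 0 := by
  have hmem : ∀ n : ℕ, (F ^ n) v ∈ W (d - n) := by
    intro n
    induction n with
    | zero => simpa using hv
    | succ n ih =>
      rw [pow_succ', Module.End.mul_apply]
      have := hF _ _ ih
      rwa [show d - (n : ℤ) - 1 = d - ((n + 1 : ℕ) : ℤ) by push_cast; ring] at this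
  have hsucc : ∀ n : ℕ, F ((F ^ n) v) = (F ^ (n + 1)) v := fun n => by
    rw [pow_succ', Module.End.mul_apply]
  -- Here `c` is the sum of the weights in degrees `d, d - 1, …, d - n`, all negative. Hence no
  -- power of `F` kills a nonzero `v`, although degrees below `e` are empty.
  have hcomm : ∀ n : ℕ, ∃ c : K, c < 0 ∧ E ((F ^ (n + 1)) v) = c • (F ^ n) v := by
    intro n
    induction n with
    | zero =>
      refine ⟨_, hd, ?_⟩
      have := hEF d v hv
      rw [hEv, map_zero, sub_zero] at this
      simpa using this
    | succ n ih =>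
      obtain ⟨c, hc, h⟩ := ih
      refine ⟨2 * ((d - (n + 1 : ℕ) : ℤ) : K) + κ + c, ?_, ?_⟩
      · push_cast
        have : (0 : K) ≤ n := Nat.cast_nonneg n
        linarith
      · have := hEF _ _ (hmem (n + 1))
        rw [h, map_smul, hsucc, hsucc, sub_eq_iff_eq_add] at this
        rw [add_smul, this]
  have hdown : ∀ n : ℕ, (F ^ n) v = 0 → v = 0 := by
    intro n
    induction n with
    | zero => simp
    | succ n ih =>
      intro h
      obtain ⟨c, hc, hE⟩ := hcomm n
      rw [h, map_zero] at hE
      exact ih ((smul_eq_zero.1 hE.symm).resolve_left hc.ne)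
  refine hdown (d - e + 1).toNat ?_
  have := hmem (d - e + 1).toNat
  rw [he _ (by have := Int.self_le_toNat (d - e + 1); omega)] at this
  simpa using this

end SlTwo

/-! ### Gelfand–Tsetlin patterns and changes of single entries. -/

/-- The boxes of an infinite triangular array whose row `k` has `k` entries. -/
abbrev Box := (k : ℕ) × Fin k

/-- The array with a single entry `1`, in the box `x`. -/
def unitBox (x : Box) : Box → ℤ := Pi.single x 1

/-- Gelfand–Tsetlin patterns with `N` rows and bottom row `L`, in strict coordinates: the entry
`i` of each row has been decreased by `i`, so that rows are strictly decreasing. -/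
structure IsPattern (N : ℕ) (L : Fin N → ℤ) (T : Box → ℤ) : Prop where
  bottom : ∀ i, T ⟨N, i⟩ = L i
  zero : ∀ x : Box, N < x.1 → T x = 0
  lt : ∀ k < N, ∀ i : Fin k, T ⟨k + 1, i.succ⟩ < T ⟨k, i⟩
  le : ∀ k < N, ∀ i : Fin k, T ⟨k, i⟩ ≤ T ⟨k + 1, i.castSucc⟩

/-- The sum of the entries of row `k`. -/
def rowSum (T : Box → ℤ) (k : ℕ) : ℤ := ∑ i : Fin k, T ⟨k, i⟩

/-- The sum of the entries in the rows above row `N`. -/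
def degree (N : ℕ) (T : Box → ℤ) : ℤ := ∑ k ∈ Finset.range N, rowSum T k

theorem unitBox_apply (x y : Box) : unitBox x y = if y = x then 1 else 0 := by
  rw [unitBox, Pi.single_apply]

theorem unitBox_self (x : Box) : unitBox x x = 1 := by rw [unitBox_apply, if_pos rfl]

theorem unitBox_of_ne {x y : Box} (h : y ≠ x) : unitBox x y = 0 := by rw [unitBox_apply, if_neg h]

theorem unitBox_nonneg (x y : Box) : 0 ≤ unitBox x y := by
  rw [unitBox_apply]; split_ifs <;> norm_num

theorem unitBox_of_row_ne {x y : Box} (h : y.1 ≠ x.1) : unitBox x y = 0 :=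
  unitBox_of_ne fun h' => h (by rw [h'])

theorem box_mk_ne {k : ℕ} {i j : Fin k} (h : i ≠ j) : (⟨k, i⟩ : Box) ≠ ⟨k, j⟩ := by
  simpa using h

section Validity

variable {N : ℕ} {L : Fin N → ℤ} {T : Box → ℤ} {x y : Box}

/-- An inequality whose smaller side is `x` survives because decreasing `y` can only make it harder;
every other inequality is inherited from `T`. With its mirror image below, this makes the two orders
of applying a raising and a lowering pass through patterns under the same condition. -/
theorem IsPattern.add_unitBox_of_add_sub (hT : IsPattern N L T)
    (h : IsPattern N L (T + unitBox x - unitBox y)) (hx : x.1 < N) (hxy : x ≠ y) :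
    IsPattern N L (T + unitBox x) := by
  have hyx : unitBox y x = 0 := unitBox_of_ne hxy
  refine ⟨fun i => ?_, fun z hz => ?_, fun k hk i => ?_, fun k hk i => ?_⟩
  · rw [Pi.add_apply, unitBox_of_row_ne (by simpa using hx.ne'), add_zero, hT.bottom]
  · rw [Pi.add_apply, unitBox_of_row_ne (by omega), add_zero, hT.zero z hz]
  · have h1 := hT.lt k hk i
    have h2 := h.lt k hk i
    have h3 := unitBox_nonneg x ⟨k, i⟩
    have h4 := unitBox_nonneg y ⟨k, i⟩
    simp only [Pi.add_apply, Pi.sub_apply] at h2 ⊢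
    by_cases hu : (⟨k + 1, i.succ⟩ : Box) = x
    · rw [← hu] at hyx
      omega
    · rw [unitBox_of_ne hu]
      omega
  · have h1 := hT.le k hk i
    have h2 := h.le k hk i
    have h3 := unitBox_nonneg x ⟨k + 1, i.castSucc⟩
    have h4 := unitBox_nonneg y ⟨k + 1, i.castSucc⟩
    simp only [Pi.add_apply, Pi.sub_apply] at h2 ⊢
    by_cases hu : (⟨k, i⟩ : Box) = x
    · rw [← hu] at hyx
      omega
    · rw [unitBox_of_ne hu]
      omega

theorem IsPattern.sub_unitBox_of_add_sub (hT : IsPattern N L T)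
    (h : IsPattern N L (T + unitBox x - unitBox y)) (hy : y.1 < N) (hxy : x ≠ y) :
    IsPattern N L (T - unitBox y) := by
  have hyx : unitBox x y = 0 := unitBox_of_ne hxy.symm
  refine ⟨fun i => ?_, fun z hz => ?_, fun k hk i => ?_, fun k hk i => ?_⟩
  · rw [Pi.sub_apply, unitBox_of_row_ne (by simpa using hy.ne'), sub_zero, hT.bottom]
  · rw [Pi.sub_apply, unitBox_of_row_ne (by omega), sub_zero, hT.zero z hz]
  · have h1 := hT.lt k hk i
    have h2 := h.lt k hk i
    have h3 := unitBox_nonneg x ⟨k + 1, i.succ⟩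
    have h4 := unitBox_nonneg y ⟨k + 1, i.succ⟩
    simp only [Pi.add_apply, Pi.sub_apply] at h2 ⊢
    by_cases hu : (⟨k, i⟩ : Box) = y
    · rw [← hu] at hyx
      omega
    · rw [unitBox_of_ne hu]
      omega
  · have h1 := hT.le k hk i
    have h2 := h.le k hk i
    have h3 := unitBox_nonneg x ⟨k, i⟩
    have h4 := unitBox_nonneg y ⟨k, i⟩
    simp only [Pi.add_apply, Pi.sub_apply] at h2 ⊢
    by_cases hu : (⟨k + 1, i.castSucc⟩ : Box) = y
    · rw [← hu] at hyx
      omega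
    · rw [unitBox_of_ne hu]
      omega

theorem IsPattern.strictAnti (hT : IsPattern N L T) {k : ℕ} (hk : k < N) :
    StrictAnti fun i : Fin (k + 1) => T ⟨k + 1, i⟩ :=
  Fin.strictAnti_iff_succ_lt.2 fun i => (hT.lt k hk i).trans_le (hT.le k hk i)

end Validity

/-! ### Gelfand–Tsetlin matrix coefficients. -/

section Coefficients

/-- `∏ (l_x - l_y)` over the other boxes `y` of the row of `x`. -/
def denom (x : Box) (T : Box → ℤ) : ℚ :=
  ∏ j ∈ Finset.univ.erase x.2, ((T x : ℚ) - T ⟨x.1, j⟩)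

/-- `∏ (l_x - l_y)` over the boxes `y` of the next row. -/
def numNext (x : Box) (T : Box → ℤ) : ℚ :=
  ∏ j : Fin (x.1 + 1), ((T x : ℚ) - T ⟨x.1 + 1, j⟩)

/-- `∏ (l_x - l_y)` over the boxes `y` of the previous row. -/
def numPrev (x : Box) (T : Box → ℤ) : ℚ :=
  ∏ j : Fin (x.1 - 1), ((T x : ℚ) - T ⟨x.1 - 1, j⟩)

/-- The Gelfand–Tsetlin coefficient of `T + unitBox x` in the raising operator applied to `T`. -/
def raiseCoeff (x : Box) (T : Box → ℤ) : ℚ := -numNext x T / denom x T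

/-- The Gelfand–Tsetlin coefficient of `T - unitBox x` in the lowering operator applied to `T`. -/
def lowerCoeff (x : Box) (T : Box → ℤ) : ℚ := numPrev x T / denom x T

theorem denom_congr {x : Box} {T T' : Box → ℤ} (h : ∀ j, T ⟨x.1, j⟩ = T' ⟨x.1, j⟩) :
    denom x T = denom x T' := by
  obtain ⟨k, i⟩ := x
  simp only [denom, h]

theorem numNext_congr {x : Box} {T T' : Box → ℤ} (h0 : T x = T' x)
    (h : ∀ j, T ⟨x.1 + 1, j⟩ = T' ⟨x.1 + 1, j⟩) : numNext x T = numNext x T' := by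
  simp only [numNext, h, h0]

theorem numPrev_congr {x : Box} {T T' : Box → ℤ} (h0 : T x = T' x)
    (h : ∀ j, T ⟨x.1 - 1, j⟩ = T' ⟨x.1 - 1, j⟩) : numPrev x T = numPrev x T' := by
  simp only [numPrev, h, h0]

/-- Isolating the factor of `denom` that comes from another box of the same row. -/
theorem denom_eq_mul {k : ℕ} {i j : Fin k} (hij : i ≠ j) (T : Box → ℤ) :
    denom ⟨k, i⟩ T = ((T ⟨k, i⟩ : ℚ) - T ⟨k, j⟩) *
      ∏ l ∈ (Finset.univ.erase i).erase j, ((T ⟨k, i⟩ : ℚ) - T ⟨k, l⟩) := by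
  rw [denom, Finset.mul_prod_erase _ (fun l => (T ⟨k, i⟩ : ℚ) - T ⟨k, l⟩)]
  simpa using hij.symm

/-- The coefficients interact only if `y` lies in the row of `x`, through one factor of each
denominator, or in the next row, through one factor of each numerator. With `a = l_x - l_y`, the two
orders contribute `(a + 1) * (-a)` and `(-a - 1) * a`, which agree. -/
theorem raiseCoeff_mul_lowerCoeff_comm (T : Box → ℤ) {x y : Box} (hxy : x ≠ y) :
    raiseCoeff x (T - unitBox y) * lowerCoeff y T =
      lowerCoeff y (T + unitBox x) * raiseCoeff x T := by
  have hTx : (T - unitBox y) x = T x := by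
    rw [Pi.sub_apply, unitBox_of_ne hxy, sub_zero]
  have hTy : (T + unitBox x) y = T y := by
    rw [Pi.add_apply, unitBox_of_ne hxy.symm, add_zero]
  have hsub : ∀ z : Box, z.1 ≠ y.1 → (T - unitBox y) z = T z := fun z hz => by
    rw [Pi.sub_apply, unitBox_of_row_ne hz, sub_zero]
  have hadd : ∀ z : Box, z.1 ≠ x.1 → (T + unitBox x) z = T z := fun z hz => by
    rw [Pi.add_apply, unitBox_of_row_ne hz, add_zero]
  by_cases h1 : y.1 = x.1
  · have e1 : numNext x (T - unitBox y) = numNext x T :=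
      numNext_congr hTx fun j => hsub _ (by simp [h1])
    have e2 : numPrev y (T + unitBox x) = numPrev y T :=
      numPrev_congr hTy fun j => hadd _ (by have := y.2.pos; simp only; omega)
    obtain ⟨k, i⟩ := x
    obtain ⟨k', j⟩ := y
    obtain rfl : k' = k := h1
    have hij : i ≠ j := fun h => hxy (by rw [h])
    rw [raiseCoeff, lowerCoeff, lowerCoeff, raiseCoeff, e1, e2, denom_eq_mul hij,
      denom_eq_mul hij, denom_eq_mul hij.symm, denom_eq_mul hij.symm, hTx, hTy]
    have p1 : ∏ l ∈ (Finset.univ.erase i).erase j,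
        ((T ⟨k', i⟩ : ℚ) - (T - unitBox ⟨k', j⟩ : Box → ℤ) ⟨k', l⟩) =
        ∏ l ∈ (Finset.univ.erase i).erase j, ((T ⟨k', i⟩ : ℚ) - T ⟨k', l⟩) := by
      refine Finset.prod_congr rfl fun l hl => ?_
      rw [Pi.sub_apply, unitBox_of_ne (box_mk_ne (Finset.ne_of_mem_erase hl)), sub_zero]
    have p2 : ∏ l ∈ (Finset.univ.erase j).erase i,
        ((T ⟨k', j⟩ : ℚ) - (T + unitBox ⟨k', i⟩ : Box → ℤ) ⟨k', l⟩) =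
        ∏ l ∈ (Finset.univ.erase j).erase i, ((T ⟨k', j⟩ : ℚ) - T ⟨k', l⟩) := by
      refine Finset.prod_congr rfl fun l hl => ?_
      rw [Pi.add_apply, unitBox_of_ne (box_mk_ne (Finset.ne_of_mem_erase hl)), add_zero]
    rw [p1, p2, Pi.sub_apply, Pi.add_apply, unitBox_self, unitBox_self, div_mul_div_comm,
      div_mul_div_comm]
    congr 1
    · ring
    · push_cast
      ring
  have e3 : denom x (T - unitBox y) = denom x T := denom_congr fun j => hsub _ (Ne.symm h1)
  have e4 : denom y (T + unitBox x) = denom y T := denom_congr fun j => hadd _ h1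
  by_cases h2 : y.1 = x.1 + 1
  · obtain ⟨k, i⟩ := x
    obtain ⟨k', j⟩ := y
    obtain rfl : k' = k + 1 := h2
    have q1 : ∀ S : Box → ℤ, numNext ⟨k, i⟩ S = ((S ⟨k, i⟩ : ℚ) - S ⟨k + 1, j⟩) *
        ∏ l ∈ Finset.univ.erase j, ((S ⟨k, i⟩ : ℚ) - S ⟨k + 1, l⟩) := fun S =>
      (Finset.mul_prod_erase _ _ (Finset.mem_univ j)).symm
    have q2 : ∀ S : Box → ℤ, numPrev ⟨k + 1, j⟩ S = ((S ⟨k + 1, j⟩ : ℚ) - S ⟨k, i⟩) *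
        ∏ l ∈ Finset.univ.erase i, ((S ⟨k + 1, j⟩ : ℚ) - S ⟨k, l⟩) := fun S =>
      (Finset.mul_prod_erase _ (fun l : Fin k => (S ⟨k + 1, j⟩ : ℚ) - S ⟨k, l⟩)
        (Finset.mem_univ i)).symm
    rw [raiseCoeff, lowerCoeff, lowerCoeff, raiseCoeff, e3, e4, q1, q1, q2, q2, hTx, hTy]
    have p1 : ∏ l ∈ Finset.univ.erase j,
        ((T ⟨k, i⟩ : ℚ) - (T - unitBox ⟨k + 1, j⟩ : Box → ℤ) ⟨k + 1, l⟩) =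
        ∏ l ∈ Finset.univ.erase j, ((T ⟨k, i⟩ : ℚ) - T ⟨k + 1, l⟩) := by
      refine Finset.prod_congr rfl fun l hl => ?_
      rw [Pi.sub_apply, unitBox_of_ne (box_mk_ne (Finset.ne_of_mem_erase hl)), sub_zero]
    have p2 : ∏ l ∈ Finset.univ.erase i,
        ((T ⟨k + 1, j⟩ : ℚ) - (T + unitBox ⟨k, i⟩ : Box → ℤ) ⟨k, l⟩) =
        ∏ l ∈ Finset.univ.erase i, ((T ⟨k + 1, j⟩ : ℚ) - T ⟨k, l⟩) := by
      refine Finset.prod_congr rfl fun l hl => ?_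
      rw [Pi.add_apply, unitBox_of_ne (box_mk_ne (Finset.ne_of_mem_erase hl)), add_zero]
    rw [p1, p2, Pi.sub_apply, Pi.add_apply, unitBox_self, unitBox_self, div_mul_div_comm,
      div_mul_div_comm]
    congr 1
    · push_cast
      ring
    · ring
  · rw [raiseCoeff, lowerCoeff, lowerCoeff, raiseCoeff, e3, e4,
      numNext_congr hTx fun j => hsub _ (Ne.symm h2),
      numPrev_congr hTy fun j => hadd _ (by have := y.2.pos; simp only; omega), mul_comm]

/-- If lowering the box `x` leaves the set of patterns, the diagonal coefficient vanishes. -/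
theorem IsPattern.raise_lower_eq_zero {N : ℕ} {L : Fin N → ℤ} {T : Box → ℤ}
    (hT : IsPattern N L T) {x : Box} (hx : x.1 < N) (h : ¬ IsPattern N L (T - unitBox x)) :
    raiseCoeff x (T - unitBox x) * lowerCoeff x T = 0 := by
  by_contra hne
  rw [raiseCoeff, lowerCoeff] at hne
  have h1 : numNext x (T - unitBox x) ≠ 0 := fun h0 => hne (by rw [h0]; simp)
  have h2 : numPrev x T ≠ 0 := fun h0 => hne (by rw [h0]; simp)
  rw [numNext, Finset.prod_ne_zero_iff] at h1
  rw [numPrev, Finset.prod_ne_zero_iff] at h2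
  -- An inequality against the next row could fail only if `numNext` vanished at the lowered array,
  -- one against the previous row only if `numPrev` vanished at `T`.
  refine h ⟨fun i => ?_, fun z hz => ?_, fun k hk i => ?_, fun k hk i => ?_⟩
  · rw [Pi.sub_apply, unitBox_of_row_ne (by simpa using hx.ne'), sub_zero, hT.bottom]
  · rw [Pi.sub_apply, unitBox_of_row_ne (by omega), sub_zero, hT.zero z hz]
  · have h3 := hT.lt k hk i
    have h4 := unitBox_nonneg x ⟨k + 1, i.succ⟩
    simp only [Pi.sub_apply]
    by_cases hu : (⟨k, i⟩ : Box) = x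
    · subst hu
      have := h1 i.succ (Finset.mem_univ _)
      rw [Pi.sub_apply, Pi.sub_apply, unitBox_self, unitBox_of_row_ne (by simp), sub_zero,
        sub_ne_zero] at this
      have h5 : T ⟨k, i⟩ - 1 ≠ T ⟨k + 1, i.succ⟩ := by exact_mod_cast this
      rw [unitBox_self, unitBox_of_row_ne (by simp)]
      omega
    · rw [unitBox_of_ne hu]
      omega
  · have h3 := hT.le k hk i
    have h4 := unitBox_nonneg x ⟨k, i⟩
    simp only [Pi.sub_apply]
    by_cases hu : (⟨k + 1, i.castSucc⟩ : Box) = x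
    · subst hu
      have := h2 i (Finset.mem_univ _)
      rw [sub_ne_zero] at this
      have h5 : T ⟨k + 1, i.castSucc⟩ ≠ T ⟨k, i⟩ := by exact_mod_cast this
      rw [unitBox_self, unitBox_of_row_ne (by simp)]
      omega
    · rw [unitBox_of_ne hu]
      omega

/-- If raising the box `x` leaves the set of patterns, the diagonal coefficient vanishes. -/
theorem IsPattern.lower_raise_eq_zero {N : ℕ} {L : Fin N → ℤ} {T : Box → ℤ}
    (hT : IsPattern N L T) {x : Box} (hx : x.1 < N) (h : ¬ IsPattern N L (T + unitBox x)) :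
    lowerCoeff x (T + unitBox x) * raiseCoeff x T = 0 := by
  by_contra hne
  rw [raiseCoeff, lowerCoeff] at hne
  have h1 : numNext x T ≠ 0 := fun h0 => hne (by rw [h0]; simp)
  have h2 : numPrev x (T + unitBox x) ≠ 0 := fun h0 => hne (by rw [h0]; simp)
  rw [numNext, Finset.prod_ne_zero_iff] at h1
  rw [numPrev, Finset.prod_ne_zero_iff] at h2
  refine h ⟨fun i => ?_, fun z hz => ?_, fun k hk i => ?_, fun k hk i => ?_⟩
  · rw [Pi.add_apply, unitBox_of_row_ne (by simpa using hx.ne'), add_zero, hT.bottom]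
  · rw [Pi.add_apply, unitBox_of_row_ne (by omega), add_zero, hT.zero z hz]
  · have h3 := hT.lt k hk i
    have h4 := unitBox_nonneg x ⟨k, i⟩
    simp only [Pi.add_apply]
    by_cases hu : (⟨k + 1, i.succ⟩ : Box) = x
    · subst hu
      have := h2 i (Finset.mem_univ _)
      rw [Pi.add_apply, unitBox_self, sub_ne_zero] at this
      have h5 : T ⟨k + 1, i.succ⟩ + 1 ≠ T ⟨k, i⟩ := by
        intro h6
        apply this
        rw [Pi.add_apply, unitBox_of_row_ne (by simp), add_zero, h6]
        rfl
      rw [unitBox_self, unitBox_of_row_ne (by simp)]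
      omega
    · rw [unitBox_of_ne hu]
      omega
  · have h3 := hT.le k hk i
    have h4 := unitBox_nonneg x ⟨k + 1, i.castSucc⟩
    simp only [Pi.add_apply]
    by_cases hu : (⟨k, i⟩ : Box) = x
    · subst hu
      have := h1 i.castSucc (Finset.mem_univ _)
      rw [sub_ne_zero] at this
      have h5 : T ⟨k, i⟩ ≠ T ⟨k + 1, i.castSucc⟩ := by exact_mod_cast this
      rw [unitBox_self, unitBox_of_row_ne (by simp)]
      omega
    · rw [unitBox_of_ne hu]
      omega

end Coefficients

/-! ### The diagonal of the commutator. -/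

/-- The two kinds of terms are the residues at `u = l i - 1` and `u = l i` of `∏ (u - p j) * ∏ (u +
1 - r j) / ∏ ((u - l i) * (u - l i + 1))`. The hypothesis `h` supplies the cancellation when a node
`l i` coincides with a node `l j - 1`. -/
theorem sum_raise_lower_residues {K : Type*} [Field K] {m : ℕ} (l : Fin (m + 1) → K)
    (p : Fin (m + 2) → K) (r : Fin m → K) (hl : Function.Injective l)
    (h : ∀ i j, l i = l j - 1 → p i.castSucc = l i ∧
      (Fin.snoc (fun k => r k - 1) (p (Fin.last _)) : Fin (m + 1) → K) j = l j - 1) :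
    ∑ i, (-(∏ j, (l i - 1 - p j)) / (∏ j ∈ Finset.univ.erase i, (l i - 1 - l j)) *
        ((∏ j, (l i - r j)) / ∏ j ∈ Finset.univ.erase i, (l i - l j)) -
      (∏ j, (l i + 1 - r j)) / (∏ j ∈ Finset.univ.erase i, (l i + 1 - l j)) *
        (-(∏ j, (l i - p j)) / ∏ j ∈ Finset.univ.erase i, (l i - l j))) =
      2 * ∑ i, l i - ∑ j, p j - ∑ j, r j - 1 := by
  let v : Fin (m + 1) ⊕ Fin (m + 1) → K := Sum.elim l fun i => l i - 1
  -- Zeros are matched with the nodes they may have to cancel: `p i` with `l i`, and `r j - 1` with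
  -- `l j - 1`. The surplus last `p` fills the slot left because `r` has one entry fewer than `l`.
  let n : Fin (m + 1) ⊕ Fin (m + 1) → K := Sum.elim (fun i => p i.castSucc)
    (Fin.snoc (fun k => r k - 1) (p (Fin.last _)) : Fin (m + 1) → K)
  have hn : ∀ u, ∏ a, (u - n a) = (∏ j, (u - p j)) * ∏ j, (u + 1 - r j) := by
    intro u
    simp only [n, Fintype.prod_sum_type, Sum.elim_inl, Sum.elim_inr]
    rw [Fin.prod_univ_castSucc (fun j : Fin (m + 2) => u - p j),
      Fin.prod_univ_castSucc (fun j => u - (Fin.snoc (fun k => r k - 1) (p (Fin.last _)) :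
        Fin (m + 1) → K) j)]
    simp only [Fin.snoc_castSucc, Fin.snoc_last]
    simp only [sub_sub_eq_add_sub]
    ring
  have key := sum_residues v n (by
    rintro (i | i) (j | j) hij hv
    · exact absurd (hl hv) (by simpa using hij)
    · exact (h i j hv).1
    · exact (h j i hv.symm).2
    · exact absurd (hl (sub_left_injective hv)) (by simpa using hij))
  rw [Fintype.sum_sum_type] at key
  have e1 : ∀ i, ∏ a ∈ Finset.univ.erase (Sum.inl i), (l i - v a) =
      (∏ j ∈ Finset.univ.erase i, (l i - l j)) *
        ∏ j ∈ Finset.univ.erase i, (l i + 1 - l j) := by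
    intro i
    have : (Finset.univ.erase (Sum.inl i) : Finset (Fin (m + 1) ⊕ Fin (m + 1))) =
        (Finset.univ.erase i).disjSum Finset.univ := by
      ext (a | a) <;> simp
    rw [this, Finset.prod_disjSum, ← Finset.mul_prod_erase Finset.univ _ (Finset.mem_univ i)]
    simp only [v, Sum.elim_inl, Sum.elim_inr, sub_sub_cancel, one_mul, sub_sub_eq_add_sub]
  have e2 : ∀ i, ∏ a ∈ Finset.univ.erase (Sum.inr i), (l i - 1 - v a) =
      -((∏ j ∈ Finset.univ.erase i, (l i - 1 - l j)) *
        ∏ j ∈ Finset.univ.erase i, (l i - l j)) := by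
    intro i
    have : (Finset.univ.erase (Sum.inr i) : Finset (Fin (m + 1) ⊕ Fin (m + 1))) =
        Finset.univ.disjSum (Finset.univ.erase i) := by
      ext (a | a) <;> simp
    rw [this, Finset.prod_disjSum, ← Finset.mul_prod_erase Finset.univ _ (Finset.mem_univ i)]
    simp only [v, Sum.elim_inl, Sum.elim_inr, sub_sub_sub_cancel_right]
    ring
  have s1 : ∑ a, v a - ∑ a, n a = 2 * ∑ i, l i - ∑ j, p j - ∑ j, r j - 1 := by
    simp only [v, n, Fintype.sum_sum_type, Sum.elim_inl, Sum.elim_inr]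
    rw [Fin.sum_univ_castSucc (fun j => p j),
      Fin.sum_univ_castSucc (Fin.snoc (fun k => r k - 1) (p (Fin.last _)) : Fin (m + 1) → K)]
    simp only [Fin.snoc_castSucc, Fin.snoc_last, Finset.sum_sub_distrib, Finset.sum_const,
      Finset.card_univ, Fintype.card_fin, nsmul_eq_mul]
    push_cast
    ring
  rw [← s1, ← key, ← Finset.sum_add_distrib]
  refine Finset.sum_congr rfl fun i _ => ?_
  rw [hn, hn, show v (Sum.inl i) = l i from rfl, show v (Sum.inr i) = l i - 1 from rfl, e1, e2,
    div_mul_div_comm, div_mul_div_comm, sub_add_cancel, div_neg]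
  rw [mul_comm (∏ j ∈ Finset.univ.erase i, (l i + 1 - l j))]
  ring

/-- The diagonal matrix coefficient of the commutator of raising and lowering at `x`. -/
def diagCoeff (x : Box) (T : Box → ℤ) : ℚ :=
  raiseCoeff x (T - unitBox x) * lowerCoeff x T - lowerCoeff x (T + unitBox x) * raiseCoeff x T

theorem IsPattern.sum_diagCoeff {N : ℕ} {L : Fin N → ℤ} {T : Box → ℤ} (hT : IsPattern N L T)
    {m : ℕ} (hm : m + 1 < N) :
    ∑ i : Fin (m + 1), diagCoeff ⟨m + 1, i⟩ T =
      2 * (rowSum T (m + 1) : ℚ) - rowSum T (m + 2) - rowSum T m - 1 := by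
  have hanti := hT.strictAnti (k := m) (by omega)
  have key := sum_raise_lower_residues (K := ℚ) (fun i : Fin (m + 1) => (T ⟨m + 1, i⟩ : ℚ))
    (fun j => T ⟨m + 2, j⟩) (fun j => T ⟨m, j⟩) (fun i j hij => hanti.injective
      (Int.cast_injective hij)) (by
    intro i j hij
    have hij' : T ⟨m + 1, i⟩ = T ⟨m + 1, j⟩ - 1 := by exact_mod_cast hij
    have hlt : j < i := hanti.lt_iff_gt.1 (by omega)
    have hj : j ≠ Fin.last m := fun h => by
      rw [h] at hlt
      exact absurd (Fin.le_last i) (not_le.2 hlt)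
    obtain ⟨k, rfl⟩ := Fin.exists_castSucc_eq.2 hj
    have hi : i = k.succ := by
      by_contra hne
      have h1 : k.succ < i := lt_of_le_of_ne (Fin.castSucc_lt_iff_succ_le.1 hlt) (Ne.symm hne)
      have h2 := hanti h1
      have h3 := hanti (Fin.castSucc_lt_succ (i := k))
      simp only at h2 h3
      omega
    subst hi
    -- The two adjacent entries are consecutive integers, so interlacing leaves a single value for
    -- the entry between them in each neighbouring row.
    have a1 : T ⟨m + 2, k.succ.castSucc⟩ < T ⟨m + 1, k.castSucc⟩ :=
      hT.lt (m + 1) hm k.castSucc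
    have a2 : T ⟨m + 1, k.succ⟩ ≤ T ⟨m + 2, k.succ.castSucc⟩ := hT.le (m + 1) hm k.succ
    have a3 := hT.lt m (by omega) k
    have a4 := hT.le m (by omega) k
    constructor
    · have : T ⟨m + 2, k.succ.castSucc⟩ = T ⟨m + 1, k.succ⟩ := by omega
      exact_mod_cast this
    · have : T ⟨m, k⟩ = T ⟨m + 1, k.castSucc⟩ := by omega
      rw [Fin.snoc_castSucc, this])
  simp only [rowSum, Int.cast_sum]
  rw [← key]
  refine Finset.sum_congr rfl fun i _ => ?_
  have d1 : denom ⟨m + 1, i⟩ (T - unitBox ⟨m + 1, i⟩) =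
      ∏ j ∈ Finset.univ.erase i, ((T ⟨m + 1, i⟩ : ℚ) - 1 - T ⟨m + 1, j⟩) := by
    rw [denom]
    refine Finset.prod_congr rfl fun j hj => ?_
    rw [Pi.sub_apply, Pi.sub_apply, unitBox_self,
      unitBox_of_ne (box_mk_ne (Finset.ne_of_mem_erase hj))]
    push_cast
    ring
  have d2 : denom ⟨m + 1, i⟩ (T + unitBox ⟨m + 1, i⟩) =
      ∏ j ∈ Finset.univ.erase i, ((T ⟨m + 1, i⟩ : ℚ) + 1 - T ⟨m + 1, j⟩) := by
    rw [denom]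
    refine Finset.prod_congr rfl fun j hj => ?_
    rw [Pi.add_apply, Pi.add_apply, unitBox_self,
      unitBox_of_ne (box_mk_ne (Finset.ne_of_mem_erase hj))]
    push_cast
    ring
  have d3 : numNext ⟨m + 1, i⟩ (T - unitBox ⟨m + 1, i⟩) =
      ∏ j, ((T ⟨m + 1, i⟩ : ℚ) - 1 - T ⟨m + 2, j⟩) := by
    rw [numNext]
    refine Finset.prod_congr rfl fun j hj => ?_
    rw [Pi.sub_apply, Pi.sub_apply, unitBox_self, unitBox_of_row_ne (by simp)]
    push_cast
    ring
  have d4 : numPrev ⟨m + 1, i⟩ (T + unitBox ⟨m + 1, i⟩) =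
      ∏ j : Fin m, ((T ⟨m + 1, i⟩ : ℚ) + 1 - T ⟨m, j⟩) := by
    rw [numPrev]
    refine Finset.prod_congr rfl fun j hj => ?_
    rw [Pi.add_apply, Pi.add_apply, unitBox_self, unitBox_of_row_ne (by simp)]
    push_cast
    rw [add_zero]
    rfl
  rw [diagCoeff, raiseCoeff, raiseCoeff, lowerCoeff, lowerCoeff, d1, d2, d3, d4]
  rfl

/-- Summation by parts twice: the weights `k * (B - k)` have constant second difference `-2`. For `B
= M + 1` the boundary term in `S M` drops out, and the one in `S (M + 1)` involves only the fixed
bottom row; this is the reason for the factors `k * (N - k)` in the lowering operator. -/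
theorem sum_secondDifference (B : ℚ) (S : ℕ → ℚ) (h0 : S 0 = 0) (M : ℕ) :
    ∑ m ∈ Finset.range M, ((m : ℚ) + 1) * (B - (m + 1)) * (2 * S (m + 1) - S (m + 2) - S m - 1) =
      2 * ∑ k ∈ Finset.range (M + 1), S k + (M + 1) * (B - M - 1) * S M - M * (B - M) * S (M + 1)
        - ∑ m ∈ Finset.range M, ((m : ℚ) + 1) * (B - (m + 1)) := by
  induction M with
  | zero => simp [h0]
  | succ M ih =>
    rw [Finset.sum_range_succ, ih, Finset.sum_range_succ _ (M + 1),
      Finset.sum_range_succ (fun m : ℕ => ((m : ℚ) + 1) * (B - (m + 1))) M]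
    push_cast
    ring

/-- The boxes in the rows above row `N`. -/
def boxes (N : ℕ) : Finset Box := (Finset.range N).sigma fun _ => Finset.univ

theorem mem_boxes {N : ℕ} {x : Box} : x ∈ boxes N ↔ x.1 < N := by simp [boxes]

/-- The additive constant in the eigenvalue `2 d + κ` of the Cartan element in degree `d`. -/
def weightShift (N : ℕ) (L : Fin N → ℤ) : ℚ :=
  -((N : ℚ) - 1) * (∑ i, L i : ℤ) -
    ∑ m ∈ Finset.range (N - 1), ((m : ℚ) + 1) * ((N : ℚ) - (m + 1))

theorem IsPattern.sum_mul_diagCoeff {N : ℕ} {L : Fin N → ℤ} {T : Box → ℤ}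
    (hT : IsPattern N L T) :
    ∑ x ∈ boxes N, ((x.1 : ℚ) * ((N : ℚ) - x.1)) * diagCoeff x T =
      2 * (degree N T : ℚ) + weightShift N L := by
  rw [boxes, Finset.sum_sigma]
  rcases N with _ | M
  · simp [degree, weightShift]
  have h0 : (rowSum T 0 : ℚ) = 0 := by simp [rowSum]
  have hN : rowSum T (M + 1) = ∑ i, L i := Finset.sum_congr rfl fun i _ => hT.bottom i
  have h := sum_secondDifference (M + 1) (fun k => (rowSum T k : ℚ)) h0 M
  simp only [hN] at h
  rw [Finset.sum_range_succ', weightShift, degree]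
  simp only [Finset.univ_eq_empty, Finset.sum_empty, add_zero, Nat.add_sub_cancel]
  push_cast at h ⊢
  have h' : ∀ m ∈ Finset.range M, ∑ i : Fin (m + 1),
      ((m : ℚ) + 1) * ((M : ℚ) + 1 - (m + 1)) * diagCoeff ⟨m + 1, i⟩ T =
      ((m : ℚ) + 1) * ((M : ℚ) + 1 - (m + 1)) *
        (2 * (rowSum T (m + 1) : ℚ) - rowSum T (m + 2) - rowSum T m - 1) := by
    intro m hm
    rw [← Finset.mul_sum, hT.sum_diagCoeff (by simpa using hm)]
  rw [Finset.sum_congr rfl h', h]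
  ring

/-! ### The principal `sl₂` acting on the span of the patterns. -/

section Operators

variable (N : ℕ) (L : Fin N → ℤ)

open Classical in
/-- The part of the raising operator that increases the entry in the box `x`. -/
noncomputable def raiseBox (x : Box) : ((Box → ℤ) →₀ ℚ) →ₗ[ℚ] ((Box → ℤ) →₀ ℚ) :=
  Finsupp.linearCombination ℚ fun T =>
    if IsPattern N L (T + unitBox x) then Finsupp.single (T + unitBox x) (raiseCoeff x T) else 0

open Classical in
/-- The part of the lowering operator that decreases the entry in the box `x`. -/
noncomputable def lowerBox (x : Box) : ((Box → ℤ) →₀ ℚ) →ₗ[ℚ] ((Box → ℤ) →₀ ℚ) :=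
  Finsupp.linearCombination ℚ fun T =>
    if IsPattern N L (T - unitBox x) then Finsupp.single (T - unitBox x) (lowerCoeff x T) else 0

/-- The raising operator of the principal `sl₂` in the Gelfand–Tsetlin basis. -/
noncomputable def raiseOp : ((Box → ℤ) →₀ ℚ) →ₗ[ℚ] ((Box → ℤ) →₀ ℚ) :=
  ∑ x ∈ boxes N, raiseBox N L x

/-- The lowering operator of the principal `sl₂` in the Gelfand–Tsetlin basis. -/
noncomputable def lowerOp : ((Box → ℤ) →₀ ℚ) →ₗ[ℚ] ((Box → ℤ) →₀ ℚ) :=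
  ∑ x ∈ boxes N, ((x.1 : ℚ) * ((N : ℚ) - x.1)) • lowerBox N L x

/-- The span of the patterns of degree `d`. -/
noncomputable def weightSpace (d : ℤ) : Submodule ℚ ((Box → ℤ) →₀ ℚ) :=
  Finsupp.supported ℚ ℚ {T | IsPattern N L T ∧ degree N T = d}

variable {N L}

open Classical in
theorem raiseBox_single (x : Box) (T : Box → ℤ) (c : ℚ) :
    raiseBox N L x (Finsupp.single T c) = if IsPattern N L (T + unitBox x) then
      Finsupp.single (T + unitBox x) (c * raiseCoeff x T) else 0 := by
  rw [raiseBox, Finsupp.linearCombination_single]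
  split_ifs <;> simp

open Classical in
theorem lowerBox_single (x : Box) (T : Box → ℤ) (c : ℚ) :
    lowerBox N L x (Finsupp.single T c) = if IsPattern N L (T - unitBox x) then
      Finsupp.single (T - unitBox x) (c * lowerCoeff x T) else 0 := by
  rw [lowerBox, Finsupp.linearCombination_single]
  split_ifs <;> simp

theorem raiseBox_lowerBox_comm {T : Box → ℤ} (hT : IsPattern N L T) {x y : Box} (hx : x.1 < N)
    (hy : y.1 < N) (hxy : x ≠ y) :
    raiseBox N L x (lowerBox N L y (Finsupp.single T 1)) =
      lowerBox N L y (raiseBox N L x (Finsupp.single T 1)) := by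
  classical
  have hcomm : T - unitBox y + unitBox x = T + unitBox x - unitBox y := by abel
  rw [raiseBox_single, lowerBox_single]
  by_cases h : IsPattern N L (T + unitBox x - unitBox y)
  · rw [if_pos (hT.add_unitBox_of_add_sub h hx hxy), if_pos (hT.sub_unitBox_of_add_sub h hy hxy),
      raiseBox_single, lowerBox_single, hcomm, if_pos h, if_pos h, one_mul, one_mul,
      mul_comm, raiseCoeff_mul_lowerCoeff_comm T hxy, mul_comm]
  · split_ifs <;> simp [raiseBox_single, lowerBox_single, hcomm, h]

theorem raiseBox_lowerBox_self {T : Box → ℤ} (hT : IsPattern N L T) {x : Box} (hx : x.1 < N) :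
    raiseBox N L x (lowerBox N L x (Finsupp.single T 1)) -
      lowerBox N L x (raiseBox N L x (Finsupp.single T 1)) =
      Finsupp.single T (diagCoeff x T) := by
  classical
  have h1 : raiseBox N L x (lowerBox N L x (Finsupp.single T 1)) =
      Finsupp.single T (raiseCoeff x (T - unitBox x) * lowerCoeff x T) := by
    rw [lowerBox_single]
    split_ifs with h
    · rw [raiseBox_single, sub_add_cancel, if_pos hT, one_mul, mul_comm]
    · rw [hT.raise_lower_eq_zero hx h, map_zero, Finsupp.single_zero]
  have h2 : lowerBox N L x (raiseBox N L x (Finsupp.single T 1)) =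
      Finsupp.single T (lowerCoeff x (T + unitBox x) * raiseCoeff x T) := by
    rw [raiseBox_single]
    split_ifs with h
    · rw [lowerBox_single, add_sub_cancel_right, if_pos hT, one_mul, mul_comm]
    · rw [hT.lower_raise_eq_zero hx h, map_zero, Finsupp.single_zero]
  rw [h1, h2, ← Finsupp.single_sub, diagCoeff]

/-- In the double sum over boxes only equal pairs survive, and each gives a multiple of the basis
vector itself; the weighted sum of these multiples is the Cartan eigenvalue. -/
theorem raiseOp_lowerOp_single {T : Box → ℤ} (hT : IsPattern N L T) :
    raiseOp N L (lowerOp N L (Finsupp.single T 1)) -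
      lowerOp N L (raiseOp N L (Finsupp.single T 1)) =
      (2 * (degree N T : ℚ) + weightShift N L) • Finsupp.single T 1 := by
  have h1 : raiseOp N L (lowerOp N L (Finsupp.single T 1)) =
      ∑ y ∈ boxes N, ∑ x ∈ boxes N, ((y.1 : ℚ) * ((N : ℚ) - y.1)) •
        raiseBox N L x (lowerBox N L y (Finsupp.single T 1)) := by
    simp only [raiseOp, lowerOp, LinearMap.sum_apply, LinearMap.smul_apply, map_sum, map_smul,
      Finset.smul_sum]
  have h2 : lowerOp N L (raiseOp N L (Finsupp.single T 1)) =
      ∑ y ∈ boxes N, ∑ x ∈ boxes N, ((y.1 : ℚ) * ((N : ℚ) - y.1)) •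
        lowerBox N L y (raiseBox N L x (Finsupp.single T 1)) := by
    simp only [raiseOp, lowerOp, LinearMap.sum_apply, LinearMap.smul_apply, map_sum]
    rw [Finset.sum_comm]
  rw [h1, h2, ← Finset.sum_sub_distrib, Finsupp.smul_single, smul_eq_mul, mul_one,
    ← hT.sum_mul_diagCoeff, Finsupp.single_finsetSum]
  refine Finset.sum_congr rfl fun y hy => ?_
  rw [← Finset.sum_sub_distrib, Finset.sum_eq_single_of_mem y hy]
  · rw [← smul_sub, raiseBox_lowerBox_self hT (mem_boxes.1 hy), Finsupp.smul_single, smul_eq_mul]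
  · intro x hx hxy
    rw [raiseBox_lowerBox_comm hT (mem_boxes.1 hx) (mem_boxes.1 hy) hxy, sub_self]

theorem degree_add (T S : Box → ℤ) : degree N (T + S) = degree N T + degree N S := by
  simp only [degree, rowSum, Pi.add_apply, Finset.sum_add_distrib]

theorem degree_unitBox {x : Box} (hx : x.1 < N) : degree N (unitBox x) = 1 := by
  have h : degree N (unitBox x) = ∑ y ∈ boxes N, unitBox x y := by
    rw [boxes, Finset.sum_sigma]
    rfl
  rw [h, Finset.sum_eq_single_of_mem x (mem_boxes.2 hx), unitBox_self]
  intro y _ hy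
  exact unitBox_of_ne hy

theorem degree_sub_unitBox (T : Box → ℤ) {x : Box} (hx : x.1 < N) :
    degree N (T - unitBox x) = degree N T - 1 := by
  have := degree_add (N := N) (T - unitBox x) (unitBox x)
  rw [sub_add_cancel, degree_unitBox hx] at this
  omega

theorem single_mem_weightSpace {T : Box → ℤ} (hT : IsPattern N L T) (c : ℚ) {d : ℤ}
    (hd : degree N T = d) : Finsupp.single T c ∈ weightSpace N L d :=
  Finsupp.single_mem_supported ℚ c ⟨hT, hd⟩

theorem weightSpace_le {d : ℤ} {M : Submodule ℚ ((Box → ℤ) →₀ ℚ)}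
    (h : ∀ T, IsPattern N L T → degree N T = d → Finsupp.single T 1 ∈ M) :
    weightSpace N L d ≤ M := by
  rw [weightSpace, Finsupp.supported_eq_span_single, Submodule.span_le]
  rintro _ ⟨T, ⟨hT, hd⟩, rfl⟩
  exact h T hT hd

theorem raiseOp_mem {d : ℤ} {v : (Box → ℤ) →₀ ℚ} (hv : v ∈ weightSpace N L d) :
    raiseOp N L v ∈ weightSpace N L (d + 1) := by
  classical
  refine weightSpace_le (M := (weightSpace N L (d + 1)).comap (raiseOp N L)) ?_ hv
  intro T hT hd
  rw [Submodule.mem_comap, raiseOp, LinearMap.sum_apply]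
  refine Submodule.sum_mem _ fun x hx => ?_
  rw [raiseBox_single]
  split_ifs with h
  · exact single_mem_weightSpace h _ (by rw [degree_add, degree_unitBox (mem_boxes.1 hx), hd])
  · exact Submodule.zero_mem _

theorem lowerOp_mem {d : ℤ} {v : (Box → ℤ) →₀ ℚ} (hv : v ∈ weightSpace N L d) :
    lowerOp N L v ∈ weightSpace N L (d - 1) := by
  classical
  refine weightSpace_le (M := (weightSpace N L (d - 1)).comap (lowerOp N L)) ?_ hv
  intro T hT hd
  rw [Submodule.mem_comap, lowerOp, LinearMap.sum_apply]
  refine Submodule.sum_mem _ fun x hx => ?_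
  rw [LinearMap.smul_apply, lowerBox_single]
  refine Submodule.smul_mem _ _ ?_
  split_ifs with h
  · exact single_mem_weightSpace h _ (by rw [degree_sub_unitBox _ (mem_boxes.1 hx), hd])
  · exact Submodule.zero_mem _

theorem raiseOp_lowerOp {d : ℤ} {v : (Box → ℤ) →₀ ℚ} (hv : v ∈ weightSpace N L d) :
    raiseOp N L (lowerOp N L v) - lowerOp N L (raiseOp N L v) =
      (2 * (d : ℚ) + weightShift N L) • v := by
  refine weightSpace_le (M := LinearMap.eqLocus
    (raiseOp N L ∘ₗ lowerOp N L - lowerOp N L ∘ₗ raiseOp N L)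
    ((2 * (d : ℚ) + weightShift N L) • LinearMap.id)) ?_ hv
  intro T hT hd
  rw [LinearMap.mem_eqLocus, ← hd]
  exact raiseOp_lowerOp_single hT

theorem weightSpace_eq_bot {d : ℤ} (h : ∀ T, IsPattern N L T → degree N T ≠ d) :
    weightSpace N L d = ⊥ :=
  eq_bot_iff.2 (weightSpace_le fun T hT hd => absurd hd (h T hT))

theorem finrank_weightSpace {S : Finset (Box → ℤ)} (hS : ∀ T, T ∈ S ↔ IsPattern N L T) (d : ℤ) :
    Module.Finite ℚ (weightSpace N L d) ∧
      Module.finrank ℚ (weightSpace N L d) = (S.filter fun T => degree N T = d).card := by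
  have hset : {T | IsPattern N L T ∧ degree N T = d} =
      ((S.filter fun T => degree N T = d : Finset _) : Set (Box → ℤ)) := by
    ext T
    simp [hS]
  rw [weightSpace, hset]
  let e := Finsupp.supportedEquivFinsupp (M := ℚ) (R := ℚ)
    ((S.filter fun T => degree N T = d : Finset _) : Set (Box → ℤ))
  refine ⟨Module.Finite.equiv e.symm, ?_⟩
  rw [e.finrank_eq, Module.finrank_finsupp_self]
  simp

theorem finrank_le_of_injOn {K V : Type*} [Field K] [AddCommGroup V] [Module K V]
    (f : V →ₗ[K] V) (A B : Submodule K V) [Module.Finite K B] (hf : ∀ v ∈ A, f v ∈ B)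
    (hinj : ∀ v ∈ A, f v = 0 → v = 0) : Module.finrank K A ≤ Module.finrank K B := by
  refine LinearMap.finrank_le_finrank_of_injective (f := f.restrict hf) ?_
  rw [← LinearMap.ker_eq_bot, LinearMap.ker_eq_bot']
  rintro ⟨v, hv⟩ h
  exact Subtype.ext (hinj v hv (congrArg Subtype.val h))

/-- The numbers of patterns of given degree first increase and then decrease. -/
theorem card_patterns_unimodal {S : Finset (Box → ℤ)} (hS : ∀ T, T ∈ S ↔ IsPattern N L T)
    (d : ℤ) :
    (2 * (d : ℚ) + weightShift N L < 0 → (S.filter fun T => degree N T = d).card ≤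
      (S.filter fun T => degree N T = d + 1).card) ∧
    (0 < 2 * (d : ℚ) + weightShift N L → (S.filter fun T => degree N T = d).card ≤
      (S.filter fun T => degree N T = d - 1).card) := by
  obtain ⟨e, he⟩ := (S.image (degree N)).bddBelow
  obtain ⟨e', he'⟩ := (S.image (degree N)).bddAbove
  have hlow : ∀ d < e, weightSpace N L d = ⊥ := fun d hd => weightSpace_eq_bot fun T hT h => by
    have : e ≤ degree N T := he (Finset.mem_image_of_mem _ ((hS T).2 hT))
    omega
  have hup : ∀ d, e' < d → weightSpace N L d = ⊥ := fun d hd => weightSpace_eq_bot fun T hT h => by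
    have : degree N T ≤ e' := he' (Finset.mem_image_of_mem _ ((hS T).2 hT))
    omega
  rw [← (finrank_weightSpace hS d).2, ← (finrank_weightSpace hS (d + 1)).2,
    ← (finrank_weightSpace hS (d - 1)).2]
  constructor
  · intro hd
    have := (finrank_weightSpace hS (d + 1)).1
    refine finrank_le_of_injOn (raiseOp N L) _ _ (fun v hv => raiseOp_mem hv) fun v hv h => ?_
    exact eq_zero_of_raise_eq_zero (raiseOp N L) (lowerOp N L) (weightSpace N L) _ e
      (fun d v hv => lowerOp_mem hv) (fun d v hv => raiseOp_lowerOp hv) hlow d hd v hv h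
  · intro hd
    have := (finrank_weightSpace hS (d - 1)).1
    refine finrank_le_of_injOn (lowerOp N L) _ _ (fun v hv => lowerOp_mem hv) fun v hv h => ?_
    -- Exchanging the two operators, reversing the grading and negating the shift gives a triple of
    -- the same kind.
    refine eq_zero_of_raise_eq_zero (lowerOp N L) (raiseOp N L) (fun d => weightSpace N L (-d))
      (-weightShift N L) (-e') (fun d v hv => ?_) (fun d v hv => ?_) (fun d hd => hup _ (by omega))
      (-d) (by push_cast; linarith) v (by rwa [neg_neg]) h
    · have := raiseOp_mem hv
      rwa [show -d + 1 = -(d - 1) by ring] at this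
    · rw [← neg_sub, raiseOp_lowerOp hv, ← neg_smul]
      congr 1
      push_cast
      ring

end Operators

/-! ### Enumeration of patterns row by row. -/

/-- Replace row `n` of an array by `R`. -/
def setRow (n : ℕ) (R : Fin n → ℤ) (T : Box → ℤ) : Box → ℤ :=
  fun x => if h : x.1 = n then R (Fin.cast h x.2) else T x

theorem setRow_self (n : ℕ) (R : Fin n → ℤ) (T : Box → ℤ) (i : Fin n) :
    setRow n R T ⟨n, i⟩ = R i := by simp [setRow]

theorem setRow_of_ne {n : ℕ} (R : Fin n → ℤ) (T : Box → ℤ) {x : Box} (h : x.1 ≠ n) :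
    setRow n R T x = T x := by simp [setRow, h]

/-- The rows that interlace with the row `L`. -/
noncomputable def interlacing {N : ℕ} (L : Fin (N + 1) → ℤ) : Finset (Fin N → ℤ) :=
  Fintype.piFinset fun i : Fin N => Finset.Ioc (L i.succ) (L i.castSucc)

theorem mem_interlacing {N : ℕ} {L : Fin (N + 1) → ℤ} {R : Fin N → ℤ} :
    R ∈ interlacing L ↔ ∀ i, L i.succ < R i ∧ R i ≤ L i.castSucc := by
  simp [interlacing]

theorem strictAnti_of_mem_interlacing {N : ℕ} {L : Fin (N + 1) → ℤ} {R : Fin N → ℤ}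
    (h : R ∈ interlacing L) : StrictAnti R := by
  rw [mem_interlacing] at h
  rcases N with _ | N
  · exact fun i => i.elim0
  · refine Fin.strictAnti_iff_succ_lt.2 fun i => ?_
    have h1 := (h i.succ).2
    have h2 := (h i.castSucc).1
    rw [Fin.succ_castSucc] at h2
    omega

open Classical in
/-- The finite set of patterns with `N` rows and bottom row `L`, built row by row. -/
noncomputable def patterns : (N : ℕ) → (Fin N → ℤ) → Finset (Box → ℤ)
  | 0, _ => {0}
  | N + 1, L => (interlacing L).biUnion fun R => (patterns N R).image (setRow (N + 1) L)

theorem IsPattern.setRow {N : ℕ} {L : Fin (N + 1) → ℤ} {R : Fin N → ℤ} (hR : R ∈ interlacing L)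
    {T : Box → ℤ} (hT : IsPattern N R T) : IsPattern (N + 1) L (setRow (N + 1) L T) := by
  rw [mem_interlacing] at hR
  refine ⟨fun i => setRow_self _ _ _ _, fun x hx => ?_, fun k hk i => ?_, fun k hk i => ?_⟩
  · rw [setRow_of_ne _ _ hx.ne', hT.zero x (by omega)]
  · rw [setRow_of_ne (x := ⟨k, i⟩) _ _ (by simp only; omega)]
    obtain hk' | rfl := Nat.lt_succ_iff_lt_or_eq.1 hk
    · rw [setRow_of_ne _ _ (by simp only; omega)]
      exact hT.lt k hk' i
    · rw [setRow_self, hT.bottom]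
      exact (hR i).1
  · rw [setRow_of_ne (x := ⟨k, i⟩) _ _ (by simp only; omega)]
    obtain hk' | rfl := Nat.lt_succ_iff_lt_or_eq.1 hk
    · rw [setRow_of_ne _ _ (by simp only; omega)]
      exact hT.le k hk' i
    · rw [setRow_self, hT.bottom]
      exact (hR i).2

theorem IsPattern.exists_setRow {N : ℕ} {L : Fin (N + 1) → ℤ} {T : Box → ℤ}
    (hT : IsPattern (N + 1) L T) :
    ∃ R ∈ interlacing L, ∃ T', IsPattern N R T' ∧ GenGauss.setRow (N + 1) L T' = T := by
  -- The bottom row is erased to `0`, since a pattern with `N` rows must vanish beyond row `N`.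
  refine ⟨fun i => T ⟨N, i⟩, mem_interlacing.2 fun i => ?_, GenGauss.setRow (N + 1) 0 T,
    ⟨fun i => ?_, fun x hx => ?_, fun k hk i => ?_, fun k hk i => ?_⟩, ?_⟩
  · rw [← hT.bottom, ← hT.bottom]
    exact ⟨hT.lt N (Nat.lt_succ_self N) i, hT.le N (Nat.lt_succ_self N) i⟩
  · rw [setRow_of_ne _ _ (by simp)]
  · by_cases h : x.1 = N + 1
    · simp [GenGauss.setRow, h]
    · rw [setRow_of_ne _ _ h, hT.zero x (by omega)]
  · rw [setRow_of_ne _ _ (by simp only; omega), setRow_of_ne _ _ (by simp only; omega)]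
    exact hT.lt k (by omega) i
  · rw [setRow_of_ne _ _ (by simp only; omega), setRow_of_ne _ _ (by simp only; omega)]
    exact hT.le k (by omega) i
  · ext ⟨k, i⟩
    by_cases h : k = N + 1
    · subst h
      rw [setRow_self, hT.bottom]
    · rw [setRow_of_ne _ _ h, setRow_of_ne _ _ h]

theorem mem_patterns {N : ℕ} {L : Fin N → ℤ} {T : Box → ℤ} :
    T ∈ patterns N L ↔ IsPattern N L T := by
  induction N generalizing T with
  | zero =>
    rw [patterns, Finset.mem_singleton]
    constructor
    · rintro rfl
      exact ⟨fun i => i.elim0, fun _ _ => rfl, fun k hk => absurd hk (Nat.not_lt_zero k),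
        fun k hk => absurd hk (Nat.not_lt_zero k)⟩
    · intro h
      ext x
      exact h.zero x x.2.pos
  | succ N ih =>
    simp only [patterns, Finset.mem_biUnion, Finset.mem_image, ih]
    constructor
    · rintro ⟨R, hR, T', hT', rfl⟩
      exact hT'.setRow hR
    · exact IsPattern.exists_setRow

theorem IsPattern.rowSum_eq {N : ℕ} {L : Fin N → ℤ} {T : Box → ℤ} (hT : IsPattern N L T) :
    rowSum T N = ∑ i, L i := Finset.sum_congr rfl fun i _ => hT.bottom i

theorem IsPattern.degree_setRow {N : ℕ} {L : Fin (N + 1) → ℤ} {R : Fin N → ℤ}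
    {T : Box → ℤ} (hT : IsPattern N R T) :
    degree (N + 1) (GenGauss.setRow (N + 1) L T) = ∑ i, R i + degree N T := by
  have h : ∀ k < N + 1, rowSum (GenGauss.setRow (N + 1) L T) k = rowSum T k := fun k hk =>
    Finset.sum_congr rfl fun i _ => setRow_of_ne _ _ (by simp only; omega)
  rw [degree, Finset.sum_range_succ, h N (by omega), hT.rowSum_eq, add_comm, degree]
  congr 1
  exact Finset.sum_congr rfl fun k hk => h k (by have := Finset.mem_range.1 hk; omega)

theorem sum_patterns_succ {M : Type*} [AddCommMonoid M] {N : ℕ} (L : Fin (N + 1) → ℤ)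
    (f : ℤ → M) :
    ∑ T ∈ patterns (N + 1) L, f (degree (N + 1) T) =
      ∑ R ∈ interlacing L, ∑ T ∈ patterns N R, f (∑ i, R i + degree N T) := by
  classical
  rw [patterns, Finset.sum_biUnion]
  · refine Finset.sum_congr rfl fun R hR => ?_
    rw [Finset.sum_image]
    · refine Finset.sum_congr rfl fun T hT => ?_
      rw [(mem_patterns.1 hT).degree_setRow]
    · intro T hT T' hT' h
      ext x
      by_cases hx : x.1 = N + 1
      · rw [(mem_patterns.1 hT).zero x (by omega), (mem_patterns.1 hT').zero x (by omega)]
      · rw [← setRow_of_ne L T hx, h, setRow_of_ne L T' hx]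
  · intro R _ R' _ hne
    rw [Function.onFun, Finset.disjoint_left]
    intro T hT hT'
    obtain ⟨S, hS, rfl⟩ := Finset.mem_image.1 hT
    obtain ⟨S', hS', h⟩ := Finset.mem_image.1 hT'
    refine hne (funext fun i => ?_)
    rw [← (mem_patterns.1 hS).bottom, ← (mem_patterns.1 hS').bottom,
      ← setRow_of_ne L S (x := ⟨N, i⟩) (by simp), ← h, setRow_of_ne _ _ (by simp)]

/-- The constant term of the least degree of a pattern. -/
def degreeShift (N : ℕ) : ℤ := ∑ k ∈ Finset.range N, ∑ j ∈ Finset.range k, ((j : ℤ) + 1)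

theorem degreeShift_succ (N : ℕ) :
    degreeShift (N + 1) = degreeShift N + ∑ i : Fin N, ((i : ℤ) + 1) := by
  rw [degreeShift, Finset.sum_range_succ, ← Fin.sum_univ_eq_sum_range (fun j => (j : ℤ) + 1),
    degreeShift]

theorem IsPattern.le_degree {N : ℕ} {L : Fin N → ℤ} {T : Box → ℤ} (hT : IsPattern N L T) :
    ∑ i : Fin N, (i : ℤ) * L i + degreeShift N ≤ degree N T := by
  induction N generalizing T with
  | zero => simp [degreeShift, degree]
  | succ N ih =>
    obtain ⟨R, hR, S, hS, rfl⟩ := hT.exists_setRow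
    rw [hS.degree_setRow, degreeShift_succ, Fin.sum_univ_succ]
    have h1 := ih hS
    -- The smallest interlacing row has entries `L i.succ + 1`. The weight `i + 1` is `i` from the
    -- inductive bound plus `1` from the row's own sum.
    have h2 : ∑ i : Fin N, ((i : ℤ) + 1) * (L i.succ + 1) ≤ ∑ i : Fin N, ((i : ℤ) + 1) * R i := by
      refine Finset.sum_le_sum fun i _ => mul_le_mul_of_nonneg_left ?_ (by positivity)
      exact (mem_interlacing.1 hR i).1
    simp only [mul_add, add_mul, one_mul, mul_one, Finset.sum_add_distrib] at h2
    simp only [Fin.val_zero, Fin.val_succ, Nat.cast_add, Nat.cast_zero, Nat.cast_one, zero_mul,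
      add_mul, one_mul, Finset.sum_add_distrib]
    linarith

/-! ### The branching rule and the product of differences. -/

section GeneratingFunction

variable {K : Type*} [Field K]

theorem prod_zpow (q : K) (hq : q ≠ 0) {ι : Type*} (s : Finset ι) (f : ι → ℤ) :
    ∏ i ∈ s, q ^ f i = q ^ ∑ i ∈ s, f i := by
  classical
  induction s using Finset.induction_on with
  | empty => simp
  | insert a s ha ih => rw [Finset.sum_insert ha, Finset.prod_insert ha, zpow_add₀ hq, ih]

theorem sum_Ioc_zpow_mul (z : K) (hz : z ≠ 0) {a b : ℤ} (hab : a ≤ b) :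
    (∑ m ∈ Finset.Ioc a b, z ^ m) * (z⁻¹ - 1) = z ^ a - z ^ b := by
  induction b, hab using Int.leInduction with
  | base => simp
  | succ b hab ih =>
    rw [← Finset.insert_Ioc_right_eq_Ioc_add_one hab, Finset.sum_insert (by simp), add_mul, ih,
      zpow_add_one₀ hz]
    field_simp
    ring

/-- Subtract from each row its predecessor and expand along the column of ones. The entries become
differences over consecutive nodes, the shape produced by telescoping geometric sums over the
interlacing intervals. -/
theorem det_vandermonde_eq_det_sub {N : ℕ} (x : Fin (N + 1) → K) :
    (Matrix.vandermonde x).det =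
      (Matrix.of fun i j : Fin N => x i.succ ^ ((j : ℕ) + 1) - x i.castSucc ^ ((j : ℕ) + 1)).det := by
  rw [Matrix.det_eq_of_forall_row_eq_smul_add_pred (A := Matrix.vandermonde x)
    (B := Matrix.of fun i j => Fin.cases (motive := fun _ => K) (x 0 ^ (j : ℕ))
      (fun i => x i.succ ^ (j : ℕ) - x i.castSucc ^ (j : ℕ)) i) (fun _ => 1)
    (fun j => by simp [Matrix.vandermonde_apply])
    (fun i j => by simp [Matrix.vandermonde_apply]),
    Matrix.det_succ_column_zero, Fin.sum_univ_succ]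
  simp only [Matrix.of_apply, Fin.cases_zero, Fin.cases_succ, Fin.val_zero, pow_zero, sub_self,
    mul_zero, zero_mul, Finset.sum_const_zero, add_zero, one_mul, mul_one]
  congr 1

/-- The branching rule, in the form of a summation formula for Vandermonde determinants. -/
theorem sum_interlacing_det_vandermonde (q : K) (hq : q ≠ 0) {N : ℕ} (L : Fin (N + 1) → ℤ)
    (hL : StrictAnti L) :
    (∑ R ∈ interlacing L, q ^ (∑ i, R i) * (Matrix.vandermonde fun i => q ^ R i).det) *
      ∏ j ∈ Finset.range N, ((q ^ (j + 1))⁻¹ - 1) =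
      (Matrix.vandermonde fun i => q ^ L i).det := by
  -- The factor `q ^ ∑ R i` raises each column exponent from `j` to `j + 1`. Since the interlacing
  -- rows form a box, multilinearity in the rows moves the sum inside the determinant.
  let g : Fin N → ℤ → Fin N → K := fun _ m j => (q ^ ((j : ℕ) + 1)) ^ m
  have h1 : ∀ R : Fin N → ℤ, q ^ (∑ i, R i) * (Matrix.vandermonde fun i => q ^ R i).det =
      Matrix.detRowAlternating.toMultilinearMap
        fun i => g i (R i) := by
    intro R
    rw [← prod_zpow q hq, ← Matrix.det_mul_column]
    change _ = Matrix.det _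
    congr 1
    ext i j
    rw [Matrix.of_apply, Matrix.vandermonde_apply, ← pow_succ', ← zpow_natCast, ← zpow_mul]
    simp only [g]
    rw [← zpow_natCast q, ← zpow_mul, mul_comm]
  rw [Finset.sum_congr rfl fun R _ => h1 R, interlacing,
    ← MultilinearMap.map_sum_finset (g := g),
    det_vandermonde_eq_det_sub, ← Fin.prod_univ_eq_prod_range (fun j => (q ^ (j + 1))⁻¹ - 1),
    mul_comm]
  change _ * Matrix.det (Matrix.of fun i =>
    ∑ m ∈ Finset.Ioc (L i.succ) (L i.castSucc), g i m) = _
  rw [← Matrix.det_mul_row]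
  congr 1
  ext i j
  rw [Matrix.of_apply, Matrix.of_apply, Matrix.of_apply, Finset.sum_apply, mul_comm,
    sum_Ioc_zpow_mul _ (pow_ne_zero _ hq) (hL Fin.castSucc_lt_succ).le]
  simp only [← zpow_natCast, ← zpow_mul, mul_comm]

theorem sum_patterns_mul (q : K) (hq : q ≠ 0) {N : ℕ} (L : Fin N → ℤ) (hL : StrictAnti L) :
    (∑ T ∈ patterns N L, q ^ degree N T) *
      ∏ k ∈ Finset.range N, ∏ j ∈ Finset.range k, ((q ^ (j + 1))⁻¹ - 1) =
      (Matrix.vandermonde fun i => q ^ L i).det := by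
  induction N with
  | zero => simp [patterns, degree]
  | succ N ih =>
    rw [sum_patterns_succ L (fun d => q ^ d), Finset.prod_range_succ, ← mul_assoc,
      Finset.sum_mul, ← sum_interlacing_det_vandermonde q hq L hL]
    congr 1
    refine Finset.sum_congr rfl fun R hR => ?_
    rw [← ih R (strictAnti_of_mem_interlacing hR), ← mul_assoc, Finset.mul_sum]
    simp only [zpow_add₀ hq]

/-- The generating function of patterns by degree, normalized to start in degree `0`. -/
theorem sum_patterns_normalized (q : K) (hq : q ≠ 0) {N : ℕ} (L : Fin N → ℤ)
    (hL : StrictAnti L) :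
    (∑ T ∈ patterns N L, q ^ (degree N T - (∑ i : Fin N, (i : ℤ) * L i + degreeShift N))) *
      ∏ k ∈ Finset.range N, ∏ j ∈ Finset.range k, (1 - q ^ (j + 1)) =
      ∏ i : Fin N, ∏ j ∈ Finset.Ioi i, (1 - q ^ (L i - L j)) := by
  have h := sum_patterns_mul q hq L hL
  have h1 : ∏ k ∈ Finset.range N, ∏ j ∈ Finset.range k, ((q ^ (j + 1))⁻¹ - 1) =
      q ^ (-degreeShift N) * ∏ k ∈ Finset.range N, ∏ j ∈ Finset.range k, (1 - q ^ (j + 1)) := by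
    rw [degreeShift, ← Finset.sum_neg_distrib, ← prod_zpow q hq, ← Finset.prod_mul_distrib]
    refine Finset.prod_congr rfl fun k _ => ?_
    rw [← Finset.sum_neg_distrib, ← prod_zpow q hq, ← Finset.prod_mul_distrib]
    refine Finset.prod_congr rfl fun j _ => ?_
    rw [zpow_neg, show ((j : ℤ) + 1) = ((j + 1 : ℕ) : ℤ) by push_cast; rfl, zpow_natCast,
      mul_sub, mul_one, inv_mul_cancel₀ (pow_ne_zero _ hq)]
  have h2 : (Matrix.vandermonde fun i => q ^ L i).det =
      q ^ (∑ i : Fin N, (i : ℤ) * L i) *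
        ∏ i : Fin N, ∏ j ∈ Finset.Ioi i, (1 - q ^ (L i - L j)) := by
    -- The factor `q ^ L j` is pulled out once for each `i < j`, that is, `j` times.
    have h3 : ∏ i : Fin N, ∏ j ∈ Finset.Ioi i, q ^ L j = q ^ (∑ i : Fin N, (i : ℤ) * L i) := by
      rw [Finset.prod_comm' (t' := Finset.univ) (s' := fun j => Finset.Iio j) (by simp),
        ← prod_zpow q hq]
      refine Finset.prod_congr rfl fun j _ => ?_
      rw [Finset.prod_const, Fin.card_Iio, mul_comm, zpow_mul, zpow_natCast]
    rw [Matrix.det_vandermonde, ← h3, ← Finset.prod_mul_distrib]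
    refine Finset.prod_congr rfl fun i _ => ?_
    rw [← Finset.prod_mul_distrib]
    refine Finset.prod_congr rfl fun j _ => ?_
    rw [mul_sub, mul_one, ← zpow_add₀ hq, add_sub_cancel]
  rw [h1, h2] at h
  apply mul_left_cancel₀ (zpow_ne_zero (∑ i : Fin N, (i : ℤ) * L i) hq)
  rw [← h, ← mul_assoc, ← mul_assoc]
  congr 1
  rw [Finset.mul_sum, Finset.sum_mul]
  refine Finset.sum_congr rfl fun T _ => ?_
  rw [← zpow_add₀ hq, ← zpow_add₀ hq]
  congr 1
  ring

end GeneratingFunction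

open Polynomial

/-! ### Hook lengths and contents of a diagram. -/

section Diagram

variable (lam : YoungDiagram) {N : ℕ}

theorem lt_rowLen_iff {i j : ℕ} : j < lam.rowLen i ↔ i < lam.colLen j := by
  rw [← YoungDiagram.mem_iff_lt_rowLen, YoungDiagram.mem_iff_lt_colLen]

theorem colLen_le (hN : lam.colLen 0 ≤ N) (j : ℕ) : lam.colLen j ≤ N :=
  (lam.colLen_anti 0 j (Nat.zero_le j)).trans hN

theorem mem_cells_iff_row (hN : lam.colLen 0 ≤ N) (x : ℕ × ℕ) :
    x ∈ lam.cells ↔ x.1 ∈ Finset.range N ∧ x.2 ∈ Finset.range (lam.rowLen x.1) := by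
  obtain ⟨i, j⟩ := x
  rw [YoungDiagram.mem_cells, YoungDiagram.mem_iff_lt_rowLen, Finset.mem_range, Finset.mem_range]
  refine ⟨fun h => ⟨?_, h⟩, fun h => h.2⟩
  exact ((lt_rowLen_iff lam).1 h).trans_le (colLen_le lam hN j)

theorem mem_cells_iff_col (x : ℕ × ℕ) :
    x ∈ lam.cells ↔ x.2 ∈ Finset.range (lam.rowLen 0) ∧ x.1 ∈ Finset.range (lam.colLen x.2) := by
  obtain ⟨i, j⟩ := x
  rw [YoungDiagram.mem_cells, YoungDiagram.mem_iff_lt_colLen, Finset.mem_range, Finset.mem_range]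
  refine ⟨fun h => ⟨?_, h⟩, fun h => h.2⟩
  exact (lt_rowLen_iff lam).2 ((Nat.zero_le i).trans_lt h)

theorem prod_cells {M : Type*} [CommMonoid M] (hN : lam.colLen 0 ≤ N) (f : ℕ × ℕ → M) :
    ∏ x ∈ lam.cells, f x =
      ∏ i ∈ Finset.range N, ∏ j ∈ Finset.range (lam.rowLen i), f (i, j) :=
  Finset.prod_finset_product _ _ _ (mem_cells_iff_row lam hN)

/-- The hook lengths in row `i` together with the differences `l_i - l_k`, `k > i`, where
`l_k = lam_k + N - 1 - k`, are the numbers `1, …, l_i`. -/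
theorem prod_hookLength_row {M : Type*} [CommMonoid M] (hN : lam.colLen 0 ≤ N) (g : ℕ → M)
    {i : ℕ} (hi : i < N) :
    (∏ j ∈ Finset.range (lam.rowLen i), g (hookLength lam (i, j))) *
      ∏ k ∈ Finset.Ioo i N, g (lam.rowLen i - lam.rowLen k + (k - i)) =
      ∏ m ∈ Finset.range (N - 1 - i + lam.rowLen i), g (m + 1) := by
  have hanti := lam.rowLen_anti
  have hcanti := lam.colLen_anti
  let φ : ℕ ⊕ ℕ → ℕ := Sum.elim
    (fun j => (lam.rowLen i - (j + 1)) + (lam.colLen j - (i + 1)))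
    (fun k => lam.rowLen i - lam.rowLen k + (k - i - 1))
  let S := (Finset.range (lam.rowLen i)).disjSum (Finset.Ioo i N)
  have hmaps : Set.MapsTo φ S (Finset.range (N - 1 - i + lam.rowLen i)) := by
    rintro (j | k) h
    · have h : j < lam.rowLen i := by simpa [S] using h
      have h1 := colLen_le lam hN j
      have h2 := (lt_rowLen_iff lam).1 h
      simp only [φ, Sum.elim_inl, Finset.coe_range, Set.mem_Iio]
      omega
    · have h : i < k ∧ k < N := by simpa [S] using h
      simp only [φ, Sum.elim_inr, Finset.coe_range, Set.mem_Iio]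
      omega
  have hinj : Set.InjOn φ S := by
    -- If `(k, j)` is in the diagram, the hook length exceeds the difference; otherwise it is
    -- smaller.
    have hne : ∀ j k, j < lam.rowLen i → i < k →
        (lam.rowLen i - (j + 1)) + (lam.colLen j - (i + 1)) ≠
          lam.rowLen i - lam.rowLen k + (k - i - 1) := by
      intro j k hj hk
      have h1 := (lt_rowLen_iff lam).1 hj
      have h2 := hanti i k hk.le
      have h3 := lt_rowLen_iff lam (i := k) (j := j)
      omega
    rintro (j | k) h (j' | k') h' hφ
    · have h : j < lam.rowLen i := by simpa [S] using h
      have h' : j' < lam.rowLen i := by simpa [S] using h'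
      simp only [φ, Sum.elim_inl] at hφ
      have h1 := (lt_rowLen_iff lam).1 h
      have h2 := (lt_rowLen_iff lam).1 h'
      rcases lt_trichotomy j j' with hlt | rfl | hlt
      · have := hcanti j j' hlt.le
        omega
      · rfl
      · have := hcanti j' j hlt.le
        omega
    · exact absurd hφ (hne j k' (by simpa [S] using h)
        (by have : i < k' ∧ k' < N := by simpa [S] using h'
            exact this.1))
    · exact absurd hφ.symm (hne j' k (by simpa [S] using h')
        (by have : i < k ∧ k < N := by simpa [S] using h
            exact this.1))
    · have h : i < k ∧ k < N := by simpa [S] using h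
      have h' : i < k' ∧ k' < N := by simpa [S] using h'
      simp only [φ, Sum.elim_inr] at hφ
      have h1 := hanti i k h.1.le
      have h2 := hanti i k' h'.1.le
      rcases lt_trichotomy k k' with hlt | rfl | hlt
      · have := hanti k k' hlt.le
        omega
      · rfl
      · have := hanti k' k hlt.le
        omega
  have hsurj : Set.SurjOn φ S (Finset.range (N - 1 - i + lam.rowLen i)) :=
    Finset.surjOn_of_injOn_of_card_le φ hmaps hinj (by
      simp only [S, Finset.card_disjSum, Finset.card_range, Nat.card_Ioo]
      omega)
  rw [← Finset.prod_nbij (s := S) (f := fun a => g (φ a + 1)) φ hmaps hinj hsurj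
    (fun a _ => rfl), Finset.prod_disjSum]
  congr 1
  refine Finset.prod_congr rfl fun k hk => ?_
  have := Finset.mem_Ioo.1 hk
  simp only [φ, Sum.elim_inr]
  congr 1
  omega

theorem sum_cells_row (f : ℕ × ℕ → ℕ) :
    ∑ x ∈ lam.cells, f x =
      ∑ i ∈ Finset.range (lam.colLen 0), ∑ j ∈ Finset.range (lam.rowLen i), f (i, j) :=
  Finset.sum_finset_product _ _ _ (mem_cells_iff_row lam le_rfl)

theorem sum_cells_col (f : ℕ × ℕ → ℕ) :
    ∑ x ∈ lam.cells, f x =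
      ∑ j ∈ Finset.range (lam.rowLen 0), ∑ i ∈ Finset.range (lam.colLen j), f (i, j) :=
  Finset.sum_finset_product_right _ _ _ (mem_cells_iff_col lam)

theorem sum_fst_cells : ∑ x ∈ lam.cells, x.1 = nStat lam := by
  rw [sum_cells_row, nStat]
  simp [mul_comm]

theorem sum_arm_cells :
    ∑ x ∈ lam.cells, (lam.rowLen x.1 - (x.2 + 1)) = ∑ x ∈ lam.cells, x.2 := by
  rw [sum_cells_row, sum_cells_row]
  refine Finset.sum_congr rfl fun i _ => ?_
  rw [← Finset.sum_range_reflect (fun j => j)]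
  exact Finset.sum_congr rfl fun j _ => by simp only; omega

theorem sum_leg_cells :
    ∑ x ∈ lam.cells, (lam.colLen x.2 - (x.1 + 1)) = ∑ x ∈ lam.cells, x.1 := by
  rw [sum_cells_col, sum_cells_col]
  refine Finset.sum_congr rfl fun i _ => ?_
  rw [← Finset.sum_range_reflect (fun j => j)]
  exact Finset.sum_congr rfl fun j _ => by simp only; omega

/-- Reversing each row turns arms into column indices, and reversing each column turns legs into row
indices. -/
theorem sum_hookLength :
    ∑ x ∈ lam.cells, hookLength lam x = ∑ x ∈ lam.cells, x.2 + nStat lam + lam.card := by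
  simp only [hookLength, Finset.sum_add_distrib]
  rw [sum_arm_cells, sum_leg_cells, sum_fst_cells]
  simp

/-- The product `∏ (1 - q ^ (N + c(x)))` over the boxes of a diagram with at most `N` rows. -/
noncomputable def contentPoly (N : ℕ) (lam : YoungDiagram) : ℤ[X] :=
  ∏ x ∈ lam.cells, (1 - X ^ (N - x.1 + x.2))

/-- The product `∏ (1 - q ^ h(x))` over the boxes of a diagram. -/
noncomputable def hookPoly (lam : YoungDiagram) : ℤ[X] :=
  ∏ x ∈ lam.cells, (1 - X ^ hookLength lam x)

theorem hookLength_pos (x : ℕ × ℕ) : 0 < hookLength lam x := Nat.succ_pos _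

theorem content_pos (hN : lam.colLen 0 ≤ N) {x : ℕ × ℕ} (hx : x ∈ lam.cells) :
    0 < N - x.1 + x.2 := by
  have := Finset.mem_range.1 ((mem_cells_iff_row lam hN x).1 hx).1
  omega

theorem gaussCoeff_transpose (N : ℕ) :
    gaussCoeff N lam.transpose = ∏ x ∈ lam.cells,
      (1 - (RatFunc.X : RatFunc ℤ) ^ ((N : ℤ) + x.2 - x.1)) /
        (1 - (RatFunc.X : RatFunc ℤ) ^ hookLength lam x) := by
  rw [gaussCoeff]
  refine Finset.prod_nbij' Prod.swap Prod.swap ?_ ?_ ?_ ?_ ?_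
  · intro x hx
    simpa using hx
  · intro x hx
    simpa using hx
  · simp
  · simp
  · rintro ⟨i, j⟩ _
    simp only [content, hookLength, YoungDiagram.rowLen_transpose, YoungDiagram.colLen_transpose,
      Prod.swap_prod_mk]
    congr 3
    · ring
    · omega

theorem gaussCoeff_transpose_eq_div (hN : lam.colLen 0 ≤ N) :
    gaussCoeff N lam.transpose = algebraMap ℤ[X] (RatFunc ℤ) (contentPoly N lam) /
      algebraMap ℤ[X] (RatFunc ℤ) (hookPoly lam) := by
  rw [gaussCoeff_transpose, contentPoly, hookPoly, map_prod, map_prod, ← Finset.prod_div_distrib]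
  refine Finset.prod_congr rfl fun x hx => ?_
  have := Finset.mem_range.1 ((mem_cells_iff_row lam hN x).1 hx).1
  simp only [map_sub, map_one, map_pow, RatFunc.algebraMap_X]
  rw [show (N : ℤ) + x.2 - x.1 = ((N - x.1 + x.2 : ℕ) : ℤ) by omega, zpow_natCast]

theorem gaussCoeff_transpose_eq_zero (hN : N < lam.colLen 0) :
    gaussCoeff N lam.transpose = 0 := by
  rw [gaussCoeff_transpose]
  -- The box `(N, 0)` has content `-N`, so its numerator is `1 - q ^ 0`.
  refine Finset.prod_eq_zero (i := (N, 0)) ?_ (by simp)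
  rwa [YoungDiagram.mem_cells, YoungDiagram.mem_iff_lt_colLen]

/-- The bottom row, in strict coordinates, of the patterns of shape `lam`. -/
def bottomRow (N : ℕ) (lam : YoungDiagram) : Fin N → ℤ := fun i => (lam.rowLen i : ℤ) - i

theorem strictAnti_bottomRow : StrictAnti (bottomRow N lam) := fun i j hij => by
  have := lam.rowLen_anti i j hij.le
  have : (i : ℕ) < j := hij
  simp only [bottomRow]
  omega

/-- The least degree of a pattern of shape `lam`. -/
def minDegree (N : ℕ) (lam : YoungDiagram) : ℤ :=
  ∑ i : Fin N, (i : ℤ) * bottomRow N lam i + degreeShift N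

/-- The generating polynomial of the patterns of shape `lam`. -/
noncomputable def patternPoly (N : ℕ) (lam : YoungDiagram) : ℤ[X] :=
  ∑ T ∈ patterns N (bottomRow N lam), X ^ (degree N T - minDegree N lam).toNat

end Diagram

/-! ### Products of factors `1 - X ^ k`. -/

theorem one_sub_X_pow_ne_zero {k : ℕ} (hk : 0 < k) : (1 - X ^ k : ℤ[X]) ≠ 0 := fun h => by
  have := congrArg (eval 0) h
  simp [hk.ne'] at this

theorem natDegree_one_sub_X_pow {k : ℕ} : (1 - X ^ k : ℤ[X]).natDegree = k := by
  rw [← neg_sub, natDegree_neg, ← C_1, natDegree_X_pow_sub_C]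

theorem reverse_one_sub_X_pow (k : ℕ) :
    (1 - X ^ k : ℤ[X]).reverse = -(1 - X ^ k) := by
  rw [reverse, natDegree_one_sub_X_pow, reflect_sub, ← C_1, reflect_C,
    reflect_monomial]
  simp [revAt_le]

theorem reverse_prod_one_sub_X_pow {ι : Type*} (s : Finset ι) (f : ι → ℕ) :
    (∏ i ∈ s, (1 - X ^ f i) : ℤ[X]).reverse = (-1) ^ s.card * ∏ i ∈ s, (1 - X ^ f i) := by
  classical
  induction s using Finset.induction_on with
  | empty =>
    rw [Finset.prod_empty, ← C_1, reverse_C]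
    simp
  | insert a s ha ih =>
    rw [Finset.prod_insert ha, reverse_mul_of_domain, ih, reverse_one_sub_X_pow,
      Finset.card_insert_of_notMem ha]
    ring

theorem prod_one_sub_X_pow_ne_zero {ι : Type*} (s : Finset ι) (f : ι → ℕ)
    (hf : ∀ i ∈ s, 0 < f i) : (∏ i ∈ s, (1 - X ^ f i) : ℤ[X]) ≠ 0 :=
  Finset.prod_ne_zero_iff.2 fun i hi => one_sub_X_pow_ne_zero (hf i hi)

theorem natDegree_prod_one_sub_X_pow {ι : Type*} (s : Finset ι) (f : ι → ℕ)
    (hf : ∀ i ∈ s, 0 < f i) : (∏ i ∈ s, (1 - X ^ f i) : ℤ[X]).natDegree = ∑ i ∈ s, f i := by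
  rw [natDegree_prod _ _ fun i hi => one_sub_X_pow_ne_zero (hf i hi)]
  exact Finset.sum_congr rfl fun i _ => natDegree_one_sub_X_pow

theorem isSymmetric_of_reverse_eq {P : ℤ[X]} (h : P.reverse = P) : IsSymmetric P := by
  intro i hi
  conv_lhs => rw [← h, coeff_reverse, revAt_le hi]

/-! ### Product formula, unimodality, symmetry and degree. -/

section Main

variable (lam : YoungDiagram) {N : ℕ}

theorem algebraMap_patternPoly :
    algebraMap ℤ[X] (RatFunc ℤ) (patternPoly N lam) =
      ∑ T ∈ patterns N (bottomRow N lam),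
        (RatFunc.X : RatFunc ℤ) ^ (degree N T - minDegree N lam) := by
  rw [patternPoly, map_sum]
  refine Finset.sum_congr rfl fun T hT => ?_
  have h : minDegree N lam ≤ degree N T := (mem_patterns.1 hT).le_degree
  rw [map_pow, RatFunc.algebraMap_X, ← zpow_natCast, Int.toNat_of_nonneg (by omega)]

theorem prod_Ioi_eq {M : Type*} [CommMonoid M] (f : ℕ → ℕ → M) :
    ∏ i : Fin N, ∏ j ∈ Finset.Ioi i, f i j =
      ∏ i ∈ Finset.range N, ∏ j ∈ Finset.Ioo i N, f i j := by
  rw [← Fin.prod_univ_eq_prod_range (fun i => ∏ j ∈ Finset.Ioo i N, f i j)]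
  refine Finset.prod_congr rfl fun i _ => ?_
  refine Finset.prod_nbij (fun j => (j : ℕ)) ?_ ?_ ?_ ?_
  · intro j hj
    simpa using hj
  · exact fun a _ b _ h => Fin.ext h
  · intro j hj
    have := Finset.mem_Ioo.1 (Finset.mem_coe.1 hj)
    exact ⟨⟨j, this.2⟩, by simpa [Fin.lt_def] using this.1, rfl⟩
  · exact fun _ _ => rfl

/-- The product of the `q`-factorials of `0, …, N - 1`. -/
noncomputable def factorialPoly (N : ℕ) : ℤ[X] :=
  ∏ k ∈ Finset.range N, ∏ j ∈ Finset.range k, (1 - X ^ (j + 1))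

/-- The product `∏ (1 - q ^ (l_i - l_k))` over `i < k`, where `l_k = lam_k + N - 1 - k`. -/
noncomputable def differencePoly (N : ℕ) (lam : YoungDiagram) : ℤ[X] :=
  ∏ i ∈ Finset.range N, ∏ k ∈ Finset.Ioo i N,
    (1 - X ^ (lam.rowLen i - lam.rowLen k + (k - i)))

theorem factorialPoly_ne_zero (N : ℕ) : factorialPoly N ≠ 0 :=
  Finset.prod_ne_zero_iff.2 fun _ _ =>
    Finset.prod_ne_zero_iff.2 fun j _ => one_sub_X_pow_ne_zero (Nat.succ_pos j)

theorem patternPoly_mul_factorialPoly (N : ℕ) :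
    patternPoly N lam * factorialPoly N = differencePoly N lam := by
  apply RatFunc.algebraMap_injective ℤ
  have hX : (RatFunc.X : RatFunc ℤ) ≠ 0 := by
    rw [← RatFunc.algebraMap_X, Ne, FaithfulSMul.algebraMap_eq_zero_iff]
    exact X_ne_zero
  have h := sum_patterns_normalized (RatFunc.X : RatFunc ℤ) hX _
    (strictAnti_bottomRow (N := N) lam)
  rw [← minDegree, ← algebraMap_patternPoly] at h
  have h1 : algebraMap ℤ[X] (RatFunc ℤ) (factorialPoly N) =
      ∏ k ∈ Finset.range N, ∏ j ∈ Finset.range k, (1 - RatFunc.X ^ (j + 1)) := by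
    simp only [factorialPoly, map_prod, map_sub, map_one, map_pow, RatFunc.algebraMap_X]
  have h2 : algebraMap ℤ[X] (RatFunc ℤ) (differencePoly N lam) =
      ∏ i ∈ Finset.range N, ∏ k ∈ Finset.Ioo i N,
        (1 - RatFunc.X ^ (lam.rowLen i - lam.rowLen k + (k - i))) := by
    simp only [differencePoly, map_prod, map_sub, map_one, map_pow, RatFunc.algebraMap_X]
  rw [map_mul, h1, h2, h,
    ← prod_Ioi_eq fun i k => 1 - RatFunc.X ^ (lam.rowLen i - lam.rowLen k + (k - i))]
  refine Finset.prod_congr rfl fun i _ => Finset.prod_congr rfl fun j hj => ?_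
  have hij : i < j := Finset.mem_Ioi.1 hj
  have hij : (i : ℕ) < j := hij
  have hle := lam.rowLen_anti i j hij.le
  have he : bottomRow N lam i - bottomRow N lam j =
      ((lam.rowLen i - lam.rowLen j + (j - i) : ℕ) : ℤ) := by
    simp only [bottomRow]
    omega
  rw [he, zpow_natCast]

/-- In row `i`, hooks and differences together give the exponents `1, …, N - 1 - i + lam_i`. The
first `N - 1 - i` of them form a `q`-factorial, and the rest are the shifted contents `N - i + j`.
-/
theorem hookPoly_mul_differencePoly (hN : lam.colLen 0 ≤ N) :
    hookPoly lam * differencePoly N lam = contentPoly N lam * factorialPoly N := by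
  rw [hookPoly, contentPoly, differencePoly, factorialPoly, prod_cells lam hN, prod_cells lam hN,
    ← Finset.prod_range_reflect (fun k => ∏ j ∈ Finset.range k, (1 - X ^ (j + 1) : ℤ[X])),
    ← Finset.prod_mul_distrib, ← Finset.prod_mul_distrib]
  refine Finset.prod_congr rfl fun i hi => ?_
  have hi := Finset.mem_range.1 hi
  rw [prod_hookLength_row lam hN (fun k => (1 - X ^ k : ℤ[X])) hi, Finset.prod_range_add,
    mul_comm]
  congr 1
  refine Finset.prod_congr rfl fun j _ => ?_
  rw [show N - 1 - i + j + 1 = N - i + j by omega]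

theorem patternPoly_mul_hookPoly (hN : lam.colLen 0 ≤ N) :
    patternPoly N lam * hookPoly lam = contentPoly N lam := by
  apply mul_right_cancel₀ (factorialPoly_ne_zero N)
  rw [← hookPoly_mul_differencePoly lam hN, ← patternPoly_mul_factorialPoly]
  ring

theorem coeff_patternPoly (n : ℕ) :
    (patternPoly N lam).coeff n = ((patterns N (bottomRow N lam)).filter
      fun T => degree N T = minDegree N lam + n).card := by
  rw [patternPoly, finsetSum_coeff]
  simp only [coeff_X_pow]
  rw [Finset.sum_boole]
  congr 2
  refine Finset.filter_congr fun T hT => ?_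
  have h : minDegree N lam ≤ degree N T := (mem_patterns.1 hT).le_degree
  omega

theorem isUnimodal_patternPoly : IsUnimodal (patternPoly N lam) := by
  classical
  have huni := fun d => card_patterns_unimodal (N := N) (L := bottomRow N lam)
    (fun T => mem_patterns) d
  have hex : ∃ m : ℕ, 0 ≤ 2 * ((minDegree N lam + m : ℤ) : ℚ) +
      weightShift N (bottomRow N lam) := by
    obtain ⟨m, hm⟩ := exists_nat_ge
      (-(2 * (minDegree N lam : ℚ) + weightShift N (bottomRow N lam)))
    refine ⟨m, ?_⟩
    push_cast
    have : (0 : ℚ) ≤ m := Nat.cast_nonneg m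
    linarith
  obtain ⟨m, hm, hmin⟩ : ∃ m : ℕ, 0 ≤ 2 * ((minDegree N lam + m : ℤ) : ℚ) +
      weightShift N (bottomRow N lam) ∧ ∀ i < m, ¬ 0 ≤ 2 * ((minDegree N lam + i : ℤ) : ℚ) +
      weightShift N (bottomRow N lam) :=
    ⟨Nat.find hex, Nat.find_spec hex, fun i hi => Nat.find_min hex hi⟩
  -- The peak is the first index of nonnegative weight. Truncating at the degree avoids comparing
  -- the two, since only indices below the degree matter on the falling side.
  refine ⟨min m (patternPoly N lam).natDegree, min_le_right _ _, ?_, ?_⟩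
  · intro i hi
    have h := hmin i (lt_of_lt_of_le hi (min_le_left _ _))
    have := (huni (minDegree N lam + i)).1 (not_le.1 h)
    rw [coeff_patternPoly, coeff_patternPoly]
    push_cast
    rw [← add_assoc]
    exact_mod_cast this
  · intro i hi hi'
    have hle : m ≤ i := by omega
    -- One step past an index of nonnegative weight, the weight is at least `2`, so lowering from
    -- degree `i + 1` is injective.
    have := (huni (minDegree N lam + (i + 1 : ℕ))).2 (by
      have : (m : ℚ) ≤ i := by exact_mod_cast hle
      push_cast at hm ⊢
      linarith)
    rw [coeff_patternPoly, coeff_patternPoly]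
    rw [show minDegree N lam + ((i + 1 : ℕ) : ℤ) - 1 = minDegree N lam + i by
      push_cast; ring] at this
    exact_mod_cast this

/-- Reversal negates each factor `1 - X ^ k`. The hook and content products have equally many
factors, so the signs cancel in the quotient. -/
theorem isSymmetric_patternPoly (hN : lam.colLen 0 ≤ N) : IsSymmetric (patternPoly N lam) := by
  apply isSymmetric_of_reverse_eq
  have h := patternPoly_mul_hookPoly lam hN
  have h' := congrArg reverse h
  have hne : hookPoly lam ≠ 0 := prod_one_sub_X_pow_ne_zero _ _ fun x _ => hookLength_pos lam x
  have e1 : (hookPoly lam).reverse = (-1) ^ lam.cells.card * hookPoly lam :=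
    reverse_prod_one_sub_X_pow _ _
  have e2 : (contentPoly N lam).reverse = (-1) ^ lam.cells.card * contentPoly N lam :=
    reverse_prod_one_sub_X_pow _ _
  rw [reverse_mul_of_domain, e1, e2, ← h] at h'
  apply mul_right_cancel₀ (mul_ne_zero (pow_ne_zero lam.cells.card
    (neg_ne_zero.2 (one_ne_zero (α := ℤ[X])))) hne)
  rw [h']
  ring

theorem patternPoly_ne_zero (hN : lam.colLen 0 ≤ N) : patternPoly N lam ≠ 0 := fun h => by
  have h' := patternPoly_mul_hookPoly lam hN
  rw [h, zero_mul] at h'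
  exact prod_one_sub_X_pow_ne_zero _ _ (fun x hx => content_pos lam hN hx) h'.symm

theorem natDegree_patternPoly (hN : lam.colLen 0 ≤ N) :
    ((patternPoly N lam).natDegree : ℤ) =
      ((N : ℤ) - 1) * (lam.card : ℤ) - 2 * (nStat lam : ℤ) := by
  have hne : hookPoly lam ≠ 0 := prod_one_sub_X_pow_ne_zero _ _ fun x _ => hookLength_pos lam x
  have h := congrArg natDegree (patternPoly_mul_hookPoly lam hN)
  rw [natDegree_mul (patternPoly_ne_zero lam hN) hne, hookPoly, contentPoly,
    natDegree_prod_one_sub_X_pow _ _ fun x _ => hookLength_pos lam x,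
    natDegree_prod_one_sub_X_pow _ _ fun x hx => content_pos lam hN hx, sum_hookLength] at h
  -- The sum of column indices also occurs in the sum of hook lengths and drops out of the
  -- difference.
  have h2 : ∑ x ∈ lam.cells, (N - x.1 + x.2) + nStat lam =
      lam.card * N + ∑ x ∈ lam.cells, x.2 := by
    rw [← sum_fst_cells, ← Finset.sum_add_distrib, YoungDiagram.card, ← smul_eq_mul,
      ← Finset.sum_const, ← Finset.sum_add_distrib]
    refine Finset.sum_congr rfl fun x hx => ?_
    have := Finset.mem_range.1 ((mem_cells_iff_row lam hN x).1 hx).1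
    omega
  zify at h h2
  linarith

end Main

end GenGauss

/-- The degree is that of the coefficient itself; the last conjunct gives the degree of
`q ^ n(lam)` times the coefficient, which is the Schur function at `1, q, …, q ^ (N - 1)`.
If `lam` has more than `N` rows the coefficient is `0` and has no degree. -/
theorem corollary1 (N : ℕ) (lam : YoungDiagram) :
    ∃ P : Polynomial ℤ,
      algebraMap (Polynomial ℤ) (RatFunc ℤ) P = GenGauss.gaussCoeff N lam.transpose ∧
      GenGauss.IsSymmetric P ∧
      GenGauss.IsUnimodal P ∧
      (lam.colLen 0 ≤ N →
        P ≠ 0 ∧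
        (P.natDegree : ℤ) = ((N : ℤ) - 1) * (lam.card : ℤ) - 2 * (GenGauss.nStat lam : ℤ) ∧
        ((Polynomial.X ^ GenGauss.nStat lam * P).natDegree : ℤ) =
          ((N : ℤ) - 1) * (lam.card : ℤ) - (GenGauss.nStat lam : ℤ)) := by
  by_cases hN : lam.colLen 0 ≤ N
  · have hne := GenGauss.patternPoly_ne_zero lam hN
    have hdeg := GenGauss.natDegree_patternPoly lam hN
    refine ⟨GenGauss.patternPoly N lam, ?_, GenGauss.isSymmetric_patternPoly lam hN,
      GenGauss.isUnimodal_patternPoly lam, fun _ => ⟨hne, hdeg, ?_⟩⟩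
    · rw [GenGauss.gaussCoeff_transpose_eq_div lam hN, eq_div_iff, ← map_mul,
        GenGauss.patternPoly_mul_hookPoly lam hN]
      rw [Ne, FaithfulSMul.algebraMap_eq_zero_iff]
      exact GenGauss.prod_one_sub_X_pow_ne_zero _ _ fun x _ => GenGauss.hookLength_pos lam x
    · rw [Polynomial.natDegree_X_pow_mul _ hne]
      push_cast
      rw [hdeg]
      ring
  · refine ⟨0, ?_, fun i _ => by simp, ⟨0, by simp, by simp, by simp⟩, fun h => absurd h hN⟩
    rw [map_zero, GenGauss.gaussCoeff_transpose_eq_zero lam (not_le.1 hN)]
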